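/- A \emph{Gauss word} is a finite word in which every letter that appears appears exactly twice; its \emph{rank} is the number of distinct letters appearing in it, and a \emph{subword} of it is a Gauss word obtained by deleting all occurrences of some (possibly empty) set of its letters. Two Gauss words are \emph{isomorphic} if a bijection between their sets of letters carries one to the other letterwise. \emph{Homotopy} of Gauss words is the equivalence relation generated by isomorphism and the moves \[ xAAy \leftrightarrow xy,\qquad xAByBAz \leftrightarrow xyz,\qquad xAByACzBCt \leftrightarrow xBAyCAzCBt , \] where $A,B,C$ are letters and $x,y,z,t$ are arbitrary words such that both sides are Gauss words. Let $v$ be a homotopy invariant of Gauss words with values in an abelian group, extended linearly to formal integer combinations of Gauss words. A Gauss word in which some letters are marked as \emph{semi-letters} (written $\dot A$) denotes the formal sum obtained by recursively applying $x\dot Ay\dot Az = xAyAz - xyz$. The invariant $v$ is a \emph{finite type invariant of degree at most $n$} if it vanishes on every Gauss word with more than $n$ semi-letters; its \emph{degree} is the least such $n\ge 0$. Let $G_4$ be the abelian group generated by the isomorphism classes of Gauss words, subject to the relations \[ xAAy=0,\qquad xAByBAz+xAyAz+xByBz=0, \] \[ xAByACzBCt+xAByAzBt+xAyACzCt+xByCzBCt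 = xBAyCAzCBt+xBAyAzBt+xAyCAzCt+xByCzCBt , \] for all Gauss words of these forms, and $w=0$ for every Gauss word $w$ of rank greater than $4$. For Gauss words $q,w$ let $\langle q,w\rangle$ be the number of subwords of $w$ isomorphic to $q$ (one subword for each set of letters of $w$ that is kept), and let $v_4(w)=\sum_{i=1}^{6}\langle w_i,w\rangle \bmod 2\in\mathbb{Z}/2$, where $w_1=ABACDCBD$, $w_2=ABCACDBD$, $w_3=ABCADBDC$, $w_4=ABCBDACD$, $w_5=ABCDBDAC$, $w_6=ABCDCADB$. \textbf{Theorem.} There is an isomorphism $G_4\cong\mathbb{Z}\oplus\mathbb{Z}/2$ which maps the class of the empty word to $(1,0)$ and the class of $w_1$ to $(0,1)$; that is, $G_4=\langle \emptyset, w_1 \mid 2w_1=0\rangle$. The map $v_4$ is a finite type invariant of degree $4$ for homotopy of Gauss words. If two Gauss words $w$ and $w'$ are distinguished by some finite type invariant of degree at most $4$ (in particular, of degree $4$) with values in an abelian group, then $v_4(w)\neq v_4(w')$. -/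

import Mathlib

/-- A word (in letters taken from the countable alphabet `ℕ`) is a Gauss word if every letter
appears in it exactly twice or not at all. -/
def IsGaussWord (l : List ℕ) : Prop := ∀ a ∈ l, l.count a = 2

/-- The type of Gauss words. -/
@[ext]
structure GaussWord : Type where
  word : List ℕ
  isGaussWord : IsGaussWord word

namespace GaussWord

/-- The set of letters appearing in a Gauss word. -/
def letters (w : GaussWord) : Finset ℕ := w.word.toFinset

/-- The rank: the number of distinct letters appearing. -/
def rank (w : GaussWord) : ℕ := w.letters.card

/-- The Gauss word obtained by deleting (both occurrences of) all letters that lie in `D`.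
The subwords of `w` are the `w.delete D`, one for each set `D` of letters of `w`. -/
def delete (w : GaussWord) (D : Finset ℕ) : GaussWord :=
  ⟨w.word.filter (fun a => decide (a ∉ D)), by
    intro a ha
    rw [List.mem_filter] at ha
    rw [List.count_filter (p := fun a => decide (a ∉ D)) ha.2]
    exact w.isGaussWord a ha.1⟩

/-- Isomorphism of Gauss words: a bijection between the sets of letters which carries,
letter by letter, the first word to the second. -/
def Iso (w w' : GaussWord) : Prop :=
  ∃ f : ℕ → ℕ, Set.InjOn f {a | a ∈ w.word} ∧ w.word.map f = w'.word

/-- Elementary transformations of Gauss words: isomorphisms and the homotopy moves H1, H2, H3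
(each in one direction). -/
inductive Move : GaussWord → GaussWord → Prop
  | iso (w w' : GaussWord) (h : Iso w w') : Move w w'
  | h1 (x y : List ℕ) (A : ℕ)
      (h : IsGaussWord (x ++ [A, A] ++ y)) (h' : IsGaussWord (x ++ y)) :
      Move ⟨x ++ [A, A] ++ y, h⟩ ⟨x ++ y, h'⟩
  | h2 (x y z : List ℕ) (A B : ℕ)
      (h : IsGaussWord (x ++ [A, B] ++ y ++ [B, A] ++ z)) (h' : IsGaussWord (x ++ y ++ z)) :
      Move ⟨x ++ [A, B] ++ y ++ [B, A] ++ z, h⟩ ⟨x ++ y ++ z, h'⟩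
  | h3 (x y z t : List ℕ) (A B C : ℕ)
      (h : IsGaussWord (x ++ [A, B] ++ y ++ [A, C] ++ z ++ [B, C] ++ t))
      (h' : IsGaussWord (x ++ [B, A] ++ y ++ [C, A] ++ z ++ [C, B] ++ t)) :
      Move ⟨x ++ [A, B] ++ y ++ [A, C] ++ z ++ [B, C] ++ t, h⟩
        ⟨x ++ [B, A] ++ y ++ [C, A] ++ z ++ [C, B] ++ t, h'⟩

/-- Homotopy of Gauss words: the equivalence relation generated by isomorphism and the moves. -/
def Homotopic : GaussWord → GaussWord → Prop := Relation.EqvGen Move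

/-- A map on Gauss words is a homotopy invariant if it is constant on homotopy classes. -/
def IsHomotopyInvariant {H : Type*} (v : GaussWord → H) : Prop :=
  ∀ w w' : GaussWord, Homotopic w w' → v w = v w'

/-- The Gauss word `w` with the letters of `D` turned into semi-letters, as a formal sum of
Gauss words: a semi-letter stands for "keep the letter" minus "remove the letter". -/
noncomputable def semi (w : GaussWord) (D : Finset ℕ) : FreeAbelianGroup GaussWord :=
  ∑ T ∈ D.powerset, (-1 : ℤ) ^ T.card • FreeAbelianGroup.of (w.delete T)

theorem semi_empty (w : GaussWord) : w.semi ∅ = FreeAbelianGroup.of w := by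
  have h : w.delete ∅ = w := GaussWord.ext (by simp [delete])
  simp [semi, h]

theorem delete_delete (w : GaussWord) (S T : Finset ℕ) :
    (w.delete S).delete T = w.delete (S ∪ T) := by
  apply GaussWord.ext
  simp only [delete, List.filter_filter]
  congr 1
  funext a
  simp [Bool.and_comm]

/-- The defining recursion of semi-letters: `xȦyȦz = xAyAz - xyz`. -/
theorem semi_insert (w : GaussWord) (D : Finset ℕ) (A : ℕ) (hA : A ∉ D) :
    w.semi (insert A D) = w.semi D - (w.delete {A}).semi D := by
  unfold semi
  rw [Finset.sum_powerset_insert hA, sub_eq_add_neg, ← Finset.sum_neg_distrib]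
  congr 1
  refine Finset.sum_congr rfl fun T hT => ?_
  have hT' : A ∉ T := fun h => hA (Finset.mem_powerset.1 hT h)
  rw [Finset.card_insert_of_notMem hT', delete_delete, ← Finset.insert_eq, pow_succ]
  simp

/-- `v` is a finite type invariant of degree at most `n`: a homotopy invariant whose linear
extension vanishes on every Gauss word with more than `n` semi-letters. -/
def IsFiniteTypeLE {H : Type*} [AddCommGroup H] (v : GaussWord → H) (n : ℕ) : Prop :=
  IsHomotopyInvariant v ∧
    ∀ (w : GaussWord) (D : Finset ℕ), D ⊆ w.letters → n < D.card →
      FreeAbelianGroup.lift v (w.semi D) = 0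

/-- `v` is a finite type invariant of degree (exactly) `n`. -/
def IsFiniteTypeOfDegree {H : Type*} [AddCommGroup H] (v : GaussWord → H) (n : ℕ) : Prop :=
  IsLeast {m : ℕ | IsFiniteTypeLE v m} n

/-- The element of the free abelian group given by a word that is a Gauss word. -/
def elt (l : List ℕ) (h : IsGaussWord l) : FreeAbelianGroup GaussWord :=
  FreeAbelianGroup.of ⟨l, h⟩

/-- The elements of the free abelian group on Gauss words which are set to zero in `G n`. -/
inductive Relator (n : ℕ) : FreeAbelianGroup GaussWord → Prop
  /-- isomorphic Gauss words are identified -/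
  | iso (w w' : GaussWord) (h : Iso w w') :
      Relator n (FreeAbelianGroup.of w - FreeAbelianGroup.of w')
  /-- `xAAy = 0` -/
  | first (x y : List ℕ) (A : ℕ) (h : IsGaussWord (x ++ [A, A] ++ y)) :
      Relator n (elt (x ++ [A, A] ++ y) h)
  /-- `xAByBAz + xAyAz + xByBz = 0` -/
  | second (x y z : List ℕ) (A B : ℕ)
      (h : IsGaussWord (x ++ [A, B] ++ y ++ [B, A] ++ z))
      (hA : IsGaussWord (x ++ [A] ++ y ++ [A] ++ z))
      (hB : IsGaussWord (x ++ [B] ++ y ++ [B] ++ z)) :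
      Relator n
        (elt (x ++ [A, B] ++ y ++ [B, A] ++ z) h
          + elt (x ++ [A] ++ y ++ [A] ++ z) hA
          + elt (x ++ [B] ++ y ++ [B] ++ z) hB)
  /-- `xAByACzBCt + xAByAzBt + xAyACzCt + xByCzBCt
      = xBAyCAzCBt + xBAyAzBt + xAyCAzCt + xByCzCBt` -/
  | third (x y z t : List ℕ) (A B C : ℕ)
      (h : IsGaussWord (x ++ [A, B] ++ y ++ [A, C] ++ z ++ [B, C] ++ t))
      (hAB : IsGaussWord (x ++ [A, B] ++ y ++ [A] ++ z ++ [B] ++ t))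
      (hAC : IsGaussWord (x ++ [A] ++ y ++ [A, C] ++ z ++ [C] ++ t))
      (hBC : IsGaussWord (x ++ [B] ++ y ++ [C] ++ z ++ [B, C] ++ t))
      (h' : IsGaussWord (x ++ [B, A] ++ y ++ [C, A] ++ z ++ [C, B] ++ t))
      (hAB' : IsGaussWord (x ++ [B, A] ++ y ++ [A] ++ z ++ [B] ++ t))
      (hAC' : IsGaussWord (x ++ [A] ++ y ++ [C, A] ++ z ++ [C] ++ t))
      (hBC' : IsGaussWord (x ++ [B] ++ y ++ [C] ++ z ++ [C, B] ++ t)) :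
      Relator n
        ((elt (x ++ [A, B] ++ y ++ [A, C] ++ z ++ [B, C] ++ t) h
          + elt (x ++ [A, B] ++ y ++ [A] ++ z ++ [B] ++ t) hAB
          + elt (x ++ [A] ++ y ++ [A, C] ++ z ++ [C] ++ t) hAC
          + elt (x ++ [B] ++ y ++ [C] ++ z ++ [B, C] ++ t) hBC)
        - (elt (x ++ [B, A] ++ y ++ [C, A] ++ z ++ [C, B] ++ t) h'
          + elt (x ++ [B, A] ++ y ++ [A] ++ z ++ [B] ++ t) hAB'
          + elt (x ++ [A] ++ y ++ [C, A] ++ z ++ [C] ++ t) hAC'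
          + elt (x ++ [B] ++ y ++ [C] ++ z ++ [C, B] ++ t) hBC'))
  /-- Gauss words of rank greater than `n` vanish -/
  | fourth (w : GaussWord) (h : n < w.rank) : Relator n (FreeAbelianGroup.of w)

/-- The group `G_n` of homotopy of Gauss words, given by generators and relations. -/
abbrev G (n : ℕ) : Type :=
  FreeAbelianGroup GaussWord ⧸ AddSubgroup.closure {r | Relator n r}

/-- The class of a Gauss word in `G n`. -/
def toG (n : ℕ) (w : GaussWord) : G n := QuotientAddGroup.mk (FreeAbelianGroup.of w)

open Classical in
/-- The angle bracket `⟨q, w⟩`: the number of subwords of `w` that are isomorphic to `q`. -/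
noncomputable def angle (q w : GaussWord) : ℕ :=
  (w.letters.powerset.filter fun D => Iso (w.delete D) q).card

/-- The trivial Gauss word. -/
def empty : GaussWord := ⟨[], by unfold IsGaussWord; decide⟩

/-- `ABACDCBD` -/
def w1 : GaussWord := ⟨[0, 1, 0, 2, 3, 2, 1, 3], by unfold IsGaussWord; decide⟩
/-- `ABCACDBD` -/
def w2 : GaussWord := ⟨[0, 1, 2, 0, 2, 3, 1, 3], by unfold IsGaussWord; decide⟩
/-- `ABCADBDC` -/
def w3 : GaussWord := ⟨[0, 1, 2, 0, 3, 1, 3, 2], by unfold IsGaussWord; decide⟩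
/-- `ABCBDACD` -/
def w4 : GaussWord := ⟨[0, 1, 2, 1, 3, 0, 2, 3], by unfold IsGaussWord; decide⟩
/-- `ABCDBDAC` -/
def w5 : GaussWord := ⟨[0, 1, 2, 3, 1, 3, 0, 2], by unfold IsGaussWord; decide⟩
/-- `ABCDCADB` -/
def w6 : GaussWord := ⟨[0, 1, 2, 3, 2, 0, 3, 1], by unfold IsGaussWord; decide⟩

/-- `v₄(w) = ⟨w₁ + ⋯ + w₆, w⟩ mod 2`. -/
noncomputable def v4 (w : GaussWord) : ZMod 2 :=
  ((angle w1 w + angle w2 w + angle w3 w + angle w4 w + angle w5 w + angle w6 w : ℕ) : ZMod 2)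

end GaussWord

namespace GaussWord

open Finset

/-! The argument is Möbius inversion over the sets of letters of a word. Summing a function over all
subwords (`lettersum 1`) turns solutions of the relations of `G n` into homotopy invariants
(`RespectsRelators.respectsMoves`). The alternating sum (`lettersum (-1)`) turns homotopy invariants
into solutions of the first three relations and of isomorphism (`RespectsMoves.respectsRelators`).
The two sums are inverse to each other (`sum_subsum_of_add_eq_zero`), and the alternating sum of `v`
at `w` is the value of `v` on `w` with all its letters made semi-letters. So an invariant of degree
at most 4 is a homomorphism on `G 4` composed with `subwordSum`, the sum of the classes of all
subwords.

It remains to compute `G 4`. For a lower bound, the mod 2 indicator `phi` of the six words respects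
the relations. It vanishes on words of rank other than 4, so up to relabelling this is a finite
check (`respectsRelators_phi`). Together with the indicator of the empty word it gives `homG : G 4
→+ ℤ × ZMod 2`. For an upper bound, an explicit list of combinations of relations shows that a
function which respects the relations, vanishes above rank 4 and kills `w1` kills every non-empty
word (`RespectsRelators.eq_zero_of_w1`). Applied modulo the class of `w1`, this makes the empty word
and `w1` generators. Since words of top rank have order at most 2, `homG` is bijective.

By construction `v4` is `lettersum 1 phi`, hence an invariant, and `homG (subwordSum w) = (1, v4
w)`. Thus `v4 w` determines `subwordSum w`, and with it every invariant of degree at most 4. -/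

instance : DecidablePred IsGaussWord := fun l =>
  inferInstanceAs (Decidable (∀ a ∈ l, l.count a = 2))

/-! ### Letter counts and relabelling -/

theorem isGaussWord_iff_count {l : List ℕ} :
    IsGaussWord l ↔ ∀ a, l.count a = 0 ∨ l.count a = 2 := by
  refine ⟨fun h a => ?_, fun h a ha => (h a).resolve_left fun h0 =>
    List.count_eq_zero.1 h0 ha⟩
  by_cases ha : a ∈ l
  · exact Or.inr (h a ha)
  · exact Or.inl (List.count_eq_zero.2 ha)

theorem isGaussWord_filter {l : List ℕ} (h : IsGaussWord l) (p : ℕ → Bool) :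
    IsGaussWord (l.filter p) := by
  intro a ha
  rw [List.mem_filter] at ha
  rw [List.count_filter ha.2]
  exact h a ha.1

/-- Injectivity is required only at `a`, and `a` need not lie in `l`, so that the hypothesis passes
to tails in the induction. -/
theorem count_map_of_injOn {l : List ℕ} {g : ℕ → ℕ} {a : ℕ}
    (hg : ∀ b ∈ l, g b = g a → b = a) : (l.map g).count (g a) = l.count a := by
  induction l with
  | nil => rfl
  | cons b l ih =>
    rw [List.map_cons, List.count_cons, List.count_cons,
      ih fun c hc => hg c (List.mem_cons_of_mem _ hc)]
    have := hg b List.mem_cons_self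
    by_cases hb : b = a
    · simp [hb]
    · have : g b ≠ g a := fun h => hb (this h)
      simp [hb, this]

theorem isGaussWord_map {l : List ℕ} {g : ℕ → ℕ} (hg : Set.InjOn g {a | a ∈ l}) :
    IsGaussWord (l.map g) ↔ IsGaussWord l := by
  have key : ∀ a ∈ l, (l.map g).count (g a) = l.count a := fun a ha =>
    count_map_of_injOn fun b hb h => hg hb ha h
  constructor
  · intro h a ha
    rw [← key a ha]
    exact h _ (List.mem_map_of_mem ha)
  · intro h b hb
    obtain ⟨a, ha, rfl⟩ := List.mem_map.1 hb
    rw [key a ha]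
    exact h a ha

theorem length_eq_two_mul_card {l : List ℕ} (h : IsGaussWord l) :
    l.length = 2 * l.toFinset.card := by
  rw [← List.sum_toFinset_count_eq_length, Finset.sum_congr rfl (g := fun _ => 2)]
  · simp [mul_comm]
  · intro a ha
    exact h a (List.mem_toFinset.1 ha)

/-! ### Freshness of the letters in a homotopy move -/

section Splitting

variable {x y z t : List ℕ} {A B C : ℕ}

theorem h1_facts (h : IsGaussWord (x ++ [A, A] ++ y)) :
    A ∉ x ++ y ∧ IsGaussWord (x ++ y) := by
  rw [isGaussWord_iff_count] at h
  simp only [List.count_append, List.count_cons, List.count_nil] at h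
  refine ⟨fun hA => ?_, isGaussWord_iff_count.2 fun a => ?_⟩
  · have h1 := h A
    have := List.count_pos_iff.2 hA
    simp only [List.count_append] at this
    simp at h1
    omega
  · have h1 := h a
    simp only [List.count_append]
    split_ifs at h1 <;> omega

theorem h2_facts (h : IsGaussWord (x ++ [A, B] ++ y ++ [B, A] ++ z)) :
    A ≠ B ∧ A ∉ x ++ y ++ z ∧ B ∉ x ++ y ++ z ∧ IsGaussWord (x ++ y ++ z) := by
  rw [isGaussWord_iff_count] at h
  simp only [List.count_append, List.count_cons, List.count_nil] at h
  refine ⟨fun hAB => ?_, fun hA => ?_, fun hB => ?_, isGaussWord_iff_count.2 fun a => ?_⟩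
  · subst hAB
    have h1 := h A
    simp at h1
    omega
  · have h1 := h A
    have := List.count_pos_iff.2 hA
    simp only [List.count_append] at this
    simp at h1
    omega
  · have h1 := h B
    have := List.count_pos_iff.2 hB
    simp only [List.count_append] at this
    simp at h1
    omega
  · have h1 := h a
    simp only [List.count_append]
    split_ifs at h1 <;> omega

theorem h3_facts (h : IsGaussWord (x ++ [A, B] ++ y ++ [A, C] ++ z ++ [B, C] ++ t)) :
    (A ≠ B ∧ A ≠ C ∧ B ≠ C) ∧
    (A ∉ x ++ y ++ z ++ t ∧ B ∉ x ++ y ++ z ++ t ∧ C ∉ x ++ y ++ z ++ t) ∧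
    IsGaussWord (x ++ y ++ z ++ t) := by
  rw [isGaussWord_iff_count] at h
  simp only [List.count_append, List.count_cons, List.count_nil] at h
  refine ⟨⟨fun e => ?_, fun e => ?_, fun e => ?_⟩, ⟨fun hA => ?_, fun hA => ?_, fun hA => ?_⟩,
    isGaussWord_iff_count.2 fun a => ?_⟩
  · subst e
    have h1 := h A
    simp at h1
    omega
  · subst e
    have h1 := h A
    simp at h1
    omega
  · subst e
    have h1 := h B
    simp at h1
    omega
  · have h1 := h A
    have := List.count_pos_iff.2 hA
    simp only [List.count_append] at this
    simp at h1
    omega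
  · have h1 := h B
    have := List.count_pos_iff.2 hA
    simp only [List.count_append] at this
    simp at h1
    omega
  · have h1 := h C
    have := List.count_pos_iff.2 hA
    simp only [List.count_append] at this
    simp at h1
    omega
  · have h1 := h a
    simp only [List.count_append]
    split_ifs at h1 <;> omega

end Splitting

/-! ### Relations, moves and weighted sums over subwords -/

/-- `f` respects the defining relations of the groups `G n`, except for the vanishing of words
of large rank. -/
structure RespectsRelators {M : Type*} [AddCommGroup M] (f : List ℕ → M) : Prop where
  iso : ∀ (l : List ℕ) (g : ℕ → ℕ), Set.InjOn g {a | a ∈ l} → f (l.map g) = f l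
  first : ∀ (x y : List ℕ) (A : ℕ), IsGaussWord (x ++ [A, A] ++ y) →
    f (x ++ [A, A] ++ y) = 0
  second : ∀ (x y z : List ℕ) (A B : ℕ), IsGaussWord (x ++ [A, B] ++ y ++ [B, A] ++ z) →
    f (x ++ [A, B] ++ y ++ [B, A] ++ z) + f (x ++ [A] ++ y ++ [A] ++ z)
      + f (x ++ [B] ++ y ++ [B] ++ z) = 0
  third : ∀ (x y z t : List ℕ) (A B C : ℕ),
    IsGaussWord (x ++ [A, B] ++ y ++ [A, C] ++ z ++ [B, C] ++ t) →
    f (x ++ [A, B] ++ y ++ [A, C] ++ z ++ [B, C] ++ t)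
      + f (x ++ [A, B] ++ y ++ [A] ++ z ++ [B] ++ t)
      + f (x ++ [A] ++ y ++ [A, C] ++ z ++ [C] ++ t)
      + f (x ++ [B] ++ y ++ [C] ++ z ++ [B, C] ++ t)
    = f (x ++ [B, A] ++ y ++ [C, A] ++ z ++ [C, B] ++ t)
      + f (x ++ [B, A] ++ y ++ [A] ++ z ++ [B] ++ t)
      + f (x ++ [A] ++ y ++ [C, A] ++ z ++ [C] ++ t)
      + f (x ++ [B] ++ y ++ [C] ++ z ++ [C, B] ++ t)

/-- `f` is invariant under isomorphism and the homotopy moves. -/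
structure RespectsMoves {M : Type*} (f : List ℕ → M) : Prop where
  iso : ∀ (l : List ℕ) (g : ℕ → ℕ), Set.InjOn g {a | a ∈ l} → f (l.map g) = f l
  h1 : ∀ (x y : List ℕ) (A : ℕ), IsGaussWord (x ++ [A, A] ++ y) →
    f (x ++ [A, A] ++ y) = f (x ++ y)
  h2 : ∀ (x y z : List ℕ) (A B : ℕ), IsGaussWord (x ++ [A, B] ++ y ++ [B, A] ++ z) →
    f (x ++ [A, B] ++ y ++ [B, A] ++ z) = f (x ++ y ++ z)
  h3 : ∀ (x y z t : List ℕ) (A B C : ℕ),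
    IsGaussWord (x ++ [A, B] ++ y ++ [A, C] ++ z ++ [B, C] ++ t) →
    f (x ++ [A, B] ++ y ++ [A, C] ++ z ++ [B, C] ++ t)
      = f (x ++ [B, A] ++ y ++ [C, A] ++ z ++ [C, B] ++ t)

/-- Deletion of the letters in `T` from a list. -/
def del (T : Finset ℕ) (l : List ℕ) : List ℕ := l.filter (fun a => decide (a ∉ T))

theorem del_append (T : Finset ℕ) (l l' : List ℕ) : del T (l ++ l') = del T l ++ del T l' :=
  List.filter_append _ _

theorem del_cons_of_notMem {T : Finset ℕ} {a : ℕ} (h : a ∉ T) (l : List ℕ) :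
    del T (a :: l) = a :: del T l := by simp [del, h]

theorem del_cons_of_mem {T : Finset ℕ} {a : ℕ} (h : a ∈ T) (l : List ℕ) :
    del T (a :: l) = del T l := by simp [del, h]

@[simp] theorem del_nil (T : Finset ℕ) : del T [] = [] := rfl

@[simp] theorem del_empty (l : List ℕ) : del ∅ l = l := by simp [del]

theorem del_eq_self {T : Finset ℕ} {l : List ℕ} (h : ∀ a ∈ T, a ∉ l) : del T l = l :=
  List.filter_eq_self.2 fun a ha => by simpa using fun h' => h a h' ha

theorem del_del (S T : Finset ℕ) (l : List ℕ) : del T (del S l) = del (S ∪ T) l := by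
  simp only [del, List.filter_filter]
  congr 1
  funext a
  simp [Bool.and_comm]

theorem mem_del {T : Finset ℕ} {l : List ℕ} {a : ℕ} : a ∈ del T l ↔ a ∈ l ∧ a ∉ T := by
  simp [del]

theorem toFinset_del (T : Finset ℕ) (l : List ℕ) : (del T l).toFinset = l.toFinset \ T := by
  ext a
  simp [mem_del]

theorem isGaussWord_del {l : List ℕ} (h : IsGaussWord l) (T : Finset ℕ) :
    IsGaussWord (del T l) := isGaussWord_filter h _

/-- The sum of the values of `f` over the words obtained from `l` by deleting letters of `L`,
weighted by powers of `ε`. -/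
def subsum {M : Type*} [AddCommGroup M] (ε : ℤ) (f : List ℕ → M) (L : Finset ℕ) (l : List ℕ) :
    M :=
  ∑ T ∈ L.powerset, ε ^ T.card • f (del T l)

section Subsum

variable {M : Type*} [AddCommGroup M] (ε : ℤ) (f : List ℕ → M)

@[simp] theorem subsum_empty (l : List ℕ) : subsum ε f ∅ l = f l := by simp [subsum]

theorem subsum_insert {L : Finset ℕ} {A : ℕ} (hA : A ∉ L) (l : List ℕ) :
    subsum ε f (insert A L) l = subsum ε f L l + ε • subsum ε f L (del {A} l) := by
  unfold subsum
  rw [Finset.sum_powerset_insert hA, Finset.smul_sum]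
  congr 1
  refine Finset.sum_congr rfl fun T hT => ?_
  have hT' : A ∉ T := fun h => hA (Finset.mem_powerset.1 hT h)
  rw [Finset.card_insert_of_notMem hT', del_del, ← Finset.insert_eq, pow_succ', mul_smul]

theorem subsum_map {L : Finset ℕ} {l : List ℕ} {g : ℕ → ℕ}
    (hf : ∀ (l : List ℕ) (g : ℕ → ℕ), Set.InjOn g {a | a ∈ l} → f (l.map g) = f l)
    (hL : L ⊆ l.toFinset) (hg : Set.InjOn g {a | a ∈ l}) :
    subsum ε f (L.image g) (l.map g) = subsum ε f L l := by
  induction L using Finset.induction_on generalizing l with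
  | empty => simpa using hf l g hg
  | insert A L hA ih =>
    have hAl : A ∈ l := by simpa using hL (Finset.mem_insert_self A L)
    have hLl : L ⊆ l.toFinset := (Finset.subset_insert A L).trans hL
    have hgA : g A ∉ L.image g := by
      intro h
      obtain ⟨b, hb, hbA⟩ := Finset.mem_image.1 h
      have : b = A := hg (by simpa using hLl hb) hAl hbA
      exact hA (this ▸ hb)
    have hmap : del {g A} (l.map g) = (del {A} l).map g := by
      simp only [del, List.filter_map]
      congr 1
      refine List.filter_congr fun b hb => ?_
      have : g b = g A ↔ b = A := ⟨fun h => hg hb hAl h, fun h => h ▸ rfl⟩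
      simp [this]
    rw [Finset.image_insert, subsum_insert ε f hgA, subsum_insert ε f hA, ih hLl hg, hmap,
      ih (l := del {A} l)]
    · rw [toFinset_del]
      intro b hb
      have : b ≠ A := fun h => hA (h ▸ hb)
      simpa [this] using hLl hb
    · exact hg.mono fun b hb => (mem_del.1 hb).1

theorem subsum_letters_map {l : List ℕ} {g : ℕ → ℕ}
    (hf : ∀ (l : List ℕ) (g : ℕ → ℕ), Set.InjOn g {a | a ∈ l} → f (l.map g) = f l)
    (hg : Set.InjOn g {a | a ∈ l}) :
    subsum ε f (l.map g).toFinset (l.map g) = subsum ε f l.toFinset l := by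
  rw [← subsum_map ε f hf (Finset.Subset.refl _) hg]
  congr 1
  ext a
  simp

/-- Möbius inversion on the letters of `D`, used with weights 1 and -1 in either order. When `A`
joins `D`, the terms for `T` and `insert A T` are paired: the part of the first in which `A` is
deleted has weight `ε` and cancels against the second, of weight `δ`. -/
theorem sum_subsum_of_add_eq_zero {δ : ℤ} (h : δ + ε = 0) {D L : Finset ℕ} (hD : Disjoint D L)
    (l : List ℕ) :
    ∑ T ∈ D.powerset, δ ^ T.card • subsum ε f (L ∪ D \ T) (del T l) = subsum ε f L l := by
  induction D using Finset.induction_on with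
  | empty => simp
  | insert A D hA ih =>
    rw [Finset.disjoint_insert_left] at hD
    rw [← ih hD.2, Finset.sum_powerset_insert hA, ← Finset.sum_add_distrib]
    refine Finset.sum_congr rfl fun T hT => ?_
    have hT' : A ∉ T := fun h => hA (Finset.mem_powerset.1 hT h)
    have e1 : L ∪ insert A D \ T = insert A (L ∪ D \ T) := by
      rw [Finset.insert_sdiff_of_notMem _ hT', Finset.union_insert]
    have e2 : L ∪ insert A D \ insert A T = L ∪ D \ T := by
      rw [Finset.insert_sdiff_insert, Finset.sdiff_insert_of_notMem hA]
    have hA' : A ∉ L ∪ D \ T := by simp [hA, hD.1]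
    rw [e1, e2, subsum_insert ε f hA', Finset.card_insert_of_notMem hT', del_del,
      Finset.insert_eq A T, Finset.union_comm {A} T, pow_succ, smul_add, add_assoc, smul_smul,
      ← add_smul, ← mul_add, add_comm ε δ, h]
    simp

theorem subsum_congr {L : Finset ℕ} {l l' : List ℕ}
    (h : ∀ T ⊆ L, f (del T l) = f (del T l')) : subsum ε f L l = subsum ε f L l' :=
  Finset.sum_congr rfl fun T hT => by rw [h T (Finset.mem_powerset.1 hT)]

end Subsum

/-! ### Expansion of letter sums along the letters of a move -/

section Transfer

variable {M : Type*} [AddCommGroup M] {ε : ℤ} {f : List ℕ → M}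

/-- The function `l ↦ ∑ ε ^ |T| f (l - T)`, where `T` runs over the sets of letters of `l`. -/
def lettersum (ε : ℤ) (f : List ℕ → M) (l : List ℕ) : M := subsum ε f l.toFinset l

theorem lettersum_h1 {x y : List ℕ} {A : ℕ} (h : IsGaussWord (x ++ [A, A] ++ y)) :
    lettersum ε f (x ++ [A, A] ++ y) = subsum ε f (x ++ y).toFinset (x ++ [A, A] ++ y)
      + ε • lettersum ε f (x ++ y) := by
  obtain ⟨hA, -⟩ := h1_facts h
  have e : (x ++ [A, A] ++ y).toFinset = insert A (x ++ y).toFinset := by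
    ext a; simp
  have d : del {A} (x ++ [A, A] ++ y) = x ++ y := by
    simp only [List.mem_append, not_or] at hA
    simp [del_append, del_cons_of_mem, del_eq_self, hA]
  rw [lettersum, e, subsum_insert ε f (by simpa using hA), d, lettersum]

theorem lettersum_single {x y z : List ℕ} {A : ℕ} (hA : A ∉ x ++ y ++ z) :
    lettersum ε f (x ++ [A] ++ y ++ [A] ++ z)
      = subsum ε f (x ++ y ++ z).toFinset (x ++ [A] ++ y ++ [A] ++ z)
        + ε • lettersum ε f (x ++ y ++ z) := by
  have e : (x ++ [A] ++ y ++ [A] ++ z).toFinset = insert A (x ++ y ++ z).toFinset := by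
    ext a; simp
  have d : del {A} (x ++ [A] ++ y ++ [A] ++ z) = x ++ y ++ z := by
    simp only [List.mem_append, not_or] at hA
    simp [del_append, del_cons_of_mem, del_eq_self, hA]
  rw [lettersum, e, subsum_insert ε f (by simpa using hA), d, lettersum]

theorem subsum_pair {L : Finset ℕ} {A B : ℕ} (hAB : A ≠ B) (hA : A ∉ L) (hB : B ∉ L)
    (l : List ℕ) :
    subsum ε f (insert A (insert B L)) l = subsum ε f L l + ε • subsum ε f L (del {B} l)
      + ε • (subsum ε f L (del {A} l) + ε • subsum ε f L (del {A, B} l)) := by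
  rw [subsum_insert ε f (by simp [hAB, hA]), subsum_insert ε f hB, subsum_insert ε f hB, del_del]
  rfl

theorem subsum_triple {L : Finset ℕ} {A B C : ℕ} (hAB : A ≠ B) (hAC : A ≠ C) (hBC : B ≠ C)
    (hA : A ∉ L) (hB : B ∉ L) (hC : C ∉ L) (l : List ℕ) :
    subsum ε f (insert A (insert B (insert C L))) l
      = subsum ε f L l + ε • subsum ε f L (del {A} l) + ε • subsum ε f L (del {B} l)
        + ε • subsum ε f L (del {C} l) + ε • ε • subsum ε f L (del {A, B} l)
        + ε • ε • subsum ε f L (del {A, C} l) + ε • ε • subsum ε f L (del {B, C} l)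
        + ε • ε • ε • subsum ε f L (del {A, B, C} l) := by
  rw [subsum_insert ε f (by simp [hAB, hAC, hA]), subsum_pair hBC hB hC,
    subsum_pair hBC hB hC, del_del, del_del, del_del]
  simp only [smul_add]
  change _ = _ + _ + _ + _ + ε • ε • subsum ε f L (del ({A} ∪ {B}) l)
    + ε • ε • subsum ε f L (del ({A} ∪ {C}) l) + _
    + ε • ε • ε • subsum ε f L (del ({A} ∪ {B, C}) l)
  abel

theorem lettersum_h2 {x y z : List ℕ} {A B : ℕ}
    (h : IsGaussWord (x ++ [A, B] ++ y ++ [B, A] ++ z)) :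
    lettersum ε f (x ++ [A, B] ++ y ++ [B, A] ++ z)
      = subsum ε f (x ++ y ++ z).toFinset (x ++ [A, B] ++ y ++ [B, A] ++ z)
        + ε • subsum ε f (x ++ y ++ z).toFinset (x ++ [A] ++ y ++ [A] ++ z)
        + ε • (subsum ε f (x ++ y ++ z).toFinset (x ++ [B] ++ y ++ [B] ++ z)
          + ε • lettersum ε f (x ++ y ++ z)) := by
  obtain ⟨hAB, hA, hB, -⟩ := h2_facts h
  have e : (x ++ [A, B] ++ y ++ [B, A] ++ z).toFinset
      = insert A (insert B (x ++ y ++ z).toFinset) := by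
    ext a; simp; tauto
  rw [lettersum, e, subsum_pair hAB (by simpa using hA) (by simpa using hB), lettersum]
  simp only [List.mem_append, not_or] at hA hB
  simp [del_append, del_cons_of_mem, del_cons_of_notMem, del_eq_self, hA, hB, hAB, hAB.symm]

section Third

variable {x y z t : List ℕ} {A B C : ℕ}

/-- This expansion and the next seven split the sum according to which of the moved letters are
deleted. Once at most one of them is left, the words on the two sides of the third move coincide, so
those terms cancel in the comparison. -/
theorem lettersum_pair_AB (hAB : A ≠ B) (hA : A ∉ x ++ y ++ z ++ t)
    (hB : B ∉ x ++ y ++ z ++ t) :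
    lettersum ε f (x ++ [A, B] ++ y ++ [A] ++ z ++ [B] ++ t)
      = subsum ε f (x ++ y ++ z ++ t).toFinset (x ++ [A, B] ++ y ++ [A] ++ z ++ [B] ++ t)
        + ε • subsum ε f (x ++ y ++ z ++ t).toFinset (x ++ [A] ++ y ++ [A] ++ z ++ t)
        + ε • (subsum ε f (x ++ y ++ z ++ t).toFinset (x ++ [B] ++ y ++ z ++ [B] ++ t)
          + ε • lettersum ε f (x ++ y ++ z ++ t)) := by
  have e : (x ++ [A, B] ++ y ++ [A] ++ z ++ [B] ++ t).toFinset
      = insert A (insert B (x ++ y ++ z ++ t).toFinset) := by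
    ext a; simp
  rw [lettersum, e, subsum_pair hAB (by simpa using hA) (by simpa using hB), lettersum]
  simp only [List.mem_append, not_or] at hA hB
  simp [del_append, del_cons_of_mem, del_cons_of_notMem, del_eq_self, hA, hB, hAB, hAB.symm]

theorem lettersum_pair_AC (hAC : A ≠ C) (hA : A ∉ x ++ y ++ z ++ t)
    (hC : C ∉ x ++ y ++ z ++ t) :
    lettersum ε f (x ++ [A] ++ y ++ [A, C] ++ z ++ [C] ++ t)
      = subsum ε f (x ++ y ++ z ++ t).toFinset (x ++ [A] ++ y ++ [A, C] ++ z ++ [C] ++ t)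
        + ε • subsum ε f (x ++ y ++ z ++ t).toFinset (x ++ [A] ++ y ++ [A] ++ z ++ t)
        + ε • (subsum ε f (x ++ y ++ z ++ t).toFinset (x ++ y ++ [C] ++ z ++ [C] ++ t)
          + ε • lettersum ε f (x ++ y ++ z ++ t)) := by
  have e : (x ++ [A] ++ y ++ [A, C] ++ z ++ [C] ++ t).toFinset
      = insert A (insert C (x ++ y ++ z ++ t).toFinset) := by
    ext a; simp
  rw [lettersum, e, subsum_pair hAC (by simpa using hA) (by simpa using hC), lettersum]
  simp only [List.mem_append, not_or] at hA hC
  simp [del_append, del_cons_of_mem, del_cons_of_notMem, del_eq_self, hA, hC, hAC, hAC.symm]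

theorem lettersum_pair_BC (hBC : B ≠ C) (hB : B ∉ x ++ y ++ z ++ t)
    (hC : C ∉ x ++ y ++ z ++ t) :
    lettersum ε f (x ++ [B] ++ y ++ [C] ++ z ++ [B, C] ++ t)
      = subsum ε f (x ++ y ++ z ++ t).toFinset (x ++ [B] ++ y ++ [C] ++ z ++ [B, C] ++ t)
        + ε • subsum ε f (x ++ y ++ z ++ t).toFinset (x ++ [B] ++ y ++ z ++ [B] ++ t)
        + ε • (subsum ε f (x ++ y ++ z ++ t).toFinset (x ++ y ++ [C] ++ z ++ [C] ++ t)
          + ε • lettersum ε f (x ++ y ++ z ++ t)) := by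
  have e : (x ++ [B] ++ y ++ [C] ++ z ++ [B, C] ++ t).toFinset
      = insert B (insert C (x ++ y ++ z ++ t).toFinset) := by
    ext a; simp
  rw [lettersum, e, subsum_pair hBC (by simpa using hB) (by simpa using hC), lettersum]
  simp only [List.mem_append, not_or] at hB hC
  simp [del_append, del_cons_of_mem, del_cons_of_notMem, del_eq_self, hB, hC, hBC, hBC.symm]

theorem lettersum_triple (hAB : A ≠ B) (hAC : A ≠ C) (hBC : B ≠ C)
    (hA : A ∉ x ++ y ++ z ++ t) (hB : B ∉ x ++ y ++ z ++ t) (hC : C ∉ x ++ y ++ z ++ t) :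
    lettersum ε f (x ++ [A, B] ++ y ++ [A, C] ++ z ++ [B, C] ++ t)
      = subsum ε f (x ++ y ++ z ++ t).toFinset (x ++ [A, B] ++ y ++ [A, C] ++ z ++ [B, C] ++ t)
        + ε • subsum ε f (x ++ y ++ z ++ t).toFinset (x ++ [B] ++ y ++ [C] ++ z ++ [B, C] ++ t)
        + ε • subsum ε f (x ++ y ++ z ++ t).toFinset (x ++ [A] ++ y ++ [A, C] ++ z ++ [C] ++ t)
        + ε • subsum ε f (x ++ y ++ z ++ t).toFinset (x ++ [A, B] ++ y ++ [A] ++ z ++ [B] ++ t)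
        + ε • ε • subsum ε f (x ++ y ++ z ++ t).toFinset (x ++ y ++ [C] ++ z ++ [C] ++ t)
        + ε • ε • subsum ε f (x ++ y ++ z ++ t).toFinset (x ++ [B] ++ y ++ z ++ [B] ++ t)
        + ε • ε • subsum ε f (x ++ y ++ z ++ t).toFinset (x ++ [A] ++ y ++ [A] ++ z ++ t)
        + ε • ε • ε • lettersum ε f (x ++ y ++ z ++ t) := by
  have e : (x ++ [A, B] ++ y ++ [A, C] ++ z ++ [B, C] ++ t).toFinset
      = insert A (insert B (insert C (x ++ y ++ z ++ t).toFinset)) := by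
    ext a; simp
  rw [lettersum, e, subsum_triple hAB hAC hBC (by simpa using hA) (by simpa using hB)
    (by simpa using hC), lettersum]
  simp only [List.mem_append, not_or] at hA hB hC
  simp [del_append, del_cons_of_mem, del_cons_of_notMem, del_eq_self, hA, hB, hC, hAB, hAB.symm,
    hAC, hAC.symm, hBC, hBC.symm]

theorem lettersum_pair_AB_swap (hAB : A ≠ B) (hA : A ∉ x ++ y ++ z ++ t)
    (hB : B ∉ x ++ y ++ z ++ t) :
    lettersum ε f (x ++ [B, A] ++ y ++ [A] ++ z ++ [B] ++ t)
      = subsum ε f (x ++ y ++ z ++ t).toFinset (x ++ [B, A] ++ y ++ [A] ++ z ++ [B] ++ t)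
        + ε • subsum ε f (x ++ y ++ z ++ t).toFinset (x ++ [A] ++ y ++ [A] ++ z ++ t)
        + ε • (subsum ε f (x ++ y ++ z ++ t).toFinset (x ++ [B] ++ y ++ z ++ [B] ++ t)
          + ε • lettersum ε f (x ++ y ++ z ++ t)) := by
  have e : (x ++ [B, A] ++ y ++ [A] ++ z ++ [B] ++ t).toFinset
      = insert A (insert B (x ++ y ++ z ++ t).toFinset) := by
    ext a; simp
  rw [lettersum, e, subsum_pair hAB (by simpa using hA) (by simpa using hB), lettersum]
  simp only [List.mem_append, not_or] at hA hB
  simp [del_append, del_cons_of_mem, del_cons_of_notMem, del_eq_self, hA, hB, hAB, hAB.symm]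

theorem lettersum_pair_AC_swap (hAC : A ≠ C) (hA : A ∉ x ++ y ++ z ++ t)
    (hC : C ∉ x ++ y ++ z ++ t) :
    lettersum ε f (x ++ [A] ++ y ++ [C, A] ++ z ++ [C] ++ t)
      = subsum ε f (x ++ y ++ z ++ t).toFinset (x ++ [A] ++ y ++ [C, A] ++ z ++ [C] ++ t)
        + ε • subsum ε f (x ++ y ++ z ++ t).toFinset (x ++ [A] ++ y ++ [A] ++ z ++ t)
        + ε • (subsum ε f (x ++ y ++ z ++ t).toFinset (x ++ y ++ [C] ++ z ++ [C] ++ t)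
          + ε • lettersum ε f (x ++ y ++ z ++ t)) := by
  have e : (x ++ [A] ++ y ++ [C, A] ++ z ++ [C] ++ t).toFinset
      = insert A (insert C (x ++ y ++ z ++ t).toFinset) := by
    ext a; simp
  rw [lettersum, e, subsum_pair hAC (by simpa using hA) (by simpa using hC), lettersum]
  simp only [List.mem_append, not_or] at hA hC
  simp [del_append, del_cons_of_mem, del_cons_of_notMem, del_eq_self, hA, hC, hAC, hAC.symm]

theorem lettersum_pair_BC_swap (hBC : B ≠ C) (hB : B ∉ x ++ y ++ z ++ t)
    (hC : C ∉ x ++ y ++ z ++ t) :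
    lettersum ε f (x ++ [B] ++ y ++ [C] ++ z ++ [C, B] ++ t)
      = subsum ε f (x ++ y ++ z ++ t).toFinset (x ++ [B] ++ y ++ [C] ++ z ++ [C, B] ++ t)
        + ε • subsum ε f (x ++ y ++ z ++ t).toFinset (x ++ [B] ++ y ++ z ++ [B] ++ t)
        + ε • (subsum ε f (x ++ y ++ z ++ t).toFinset (x ++ y ++ [C] ++ z ++ [C] ++ t)
          + ε • lettersum ε f (x ++ y ++ z ++ t)) := by
  have e : (x ++ [B] ++ y ++ [C] ++ z ++ [C, B] ++ t).toFinset
      = insert B (insert C (x ++ y ++ z ++ t).toFinset) := by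
    ext a; simp; tauto
  rw [lettersum, e, subsum_pair hBC (by simpa using hB) (by simpa using hC), lettersum]
  simp only [List.mem_append, not_or] at hB hC
  simp [del_append, del_cons_of_mem, del_cons_of_notMem, del_eq_self, hB, hC, hBC, hBC.symm]

theorem lettersum_triple_swap (hAB : A ≠ B) (hAC : A ≠ C) (hBC : B ≠ C)
    (hA : A ∉ x ++ y ++ z ++ t) (hB : B ∉ x ++ y ++ z ++ t) (hC : C ∉ x ++ y ++ z ++ t) :
    lettersum ε f (x ++ [B, A] ++ y ++ [C, A] ++ z ++ [C, B] ++ t)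
      = subsum ε f (x ++ y ++ z ++ t).toFinset (x ++ [B, A] ++ y ++ [C, A] ++ z ++ [C, B] ++ t)
        + ε • subsum ε f (x ++ y ++ z ++ t).toFinset (x ++ [B] ++ y ++ [C] ++ z ++ [C, B] ++ t)
        + ε • subsum ε f (x ++ y ++ z ++ t).toFinset (x ++ [A] ++ y ++ [C, A] ++ z ++ [C] ++ t)
        + ε • subsum ε f (x ++ y ++ z ++ t).toFinset (x ++ [B, A] ++ y ++ [A] ++ z ++ [B] ++ t)
        + ε • ε • subsum ε f (x ++ y ++ z ++ t).toFinset (x ++ y ++ [C] ++ z ++ [C] ++ t)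
        + ε • ε • subsum ε f (x ++ y ++ z ++ t).toFinset (x ++ [B] ++ y ++ z ++ [B] ++ t)
        + ε • ε • subsum ε f (x ++ y ++ z ++ t).toFinset (x ++ [A] ++ y ++ [A] ++ z ++ t)
        + ε • ε • ε • lettersum ε f (x ++ y ++ z ++ t) := by
  have e : (x ++ [B, A] ++ y ++ [C, A] ++ z ++ [C, B] ++ t).toFinset
      = insert A (insert B (insert C (x ++ y ++ z ++ t).toFinset)) := by
    ext a; simp; tauto
  rw [lettersum, e, subsum_triple hAB hAC hBC (by simpa using hA) (by simpa using hB)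
    (by simpa using hC), lettersum]
  simp only [List.mem_append, not_or] at hA hB hC
  simp [del_append, del_cons_of_mem, del_cons_of_notMem, del_eq_self, hA, hB, hC, hAB, hAB.symm,
    hAC, hAC.symm, hBC, hBC.symm]

end Third

end Transfer

/-! ### Exchange of relations and moves under inversion -/

section Transfer

variable {M : Type*} [AddCommGroup M] {f : List ℕ → M}

theorem RespectsRelators.respectsMoves (hf : RespectsRelators f) :
    RespectsMoves (lettersum 1 f) where
  iso l g hg := subsum_letters_map 1 f hf.iso hg
  h1 x y A h := by
    have hA : A ∉ x ++ y := (h1_facts h).1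
    -- The subwords without `A` give the sum for `xy`; those that keep `A` still contain `AA` and
    -- vanish one by one.
    rw [lettersum_h1 h, one_smul, add_eq_right]
    refine Finset.sum_eq_zero fun T hT => ?_
    have hT' : A ∉ T := fun h => hA (by simpa using Finset.mem_powerset.1 hT h)
    have hd := isGaussWord_del h T
    simp only [del_append, del_cons_of_notMem hT', del_nil] at hd ⊢
    rw [hf.first _ _ _ hd, smul_zero]
  h2 x y z A B h := by
    obtain ⟨hAB, hA, hB, -⟩ := h2_facts h
    rw [lettersum_h2 h, one_smul, one_smul, one_smul, ← add_assoc, add_eq_right]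
    simp only [subsum]
    rw [← Finset.sum_add_distrib, ← Finset.sum_add_distrib]
    refine Finset.sum_eq_zero fun T hT => ?_
    have hAT : A ∉ T := fun h => hA (by simpa using Finset.mem_powerset.1 hT h)
    have hBT : B ∉ T := fun h => hB (by simpa using Finset.mem_powerset.1 hT h)
    have hd := isGaussWord_del h T
    simp only [del_append, del_cons_of_notMem hAT, del_cons_of_notMem hBT, del_nil] at hd ⊢
    rw [← smul_add, ← smul_add, hf.second _ _ _ _ _ hd, smul_zero]
  h3 x y z t A B C h := by
    obtain ⟨⟨hAB, hAC, hBC⟩, ⟨hA, hB, hC⟩, -⟩ := h3_facts h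
    rw [lettersum_triple hAB hAC hBC hA hB hC, lettersum_triple_swap hAB hAC hBC hA hB hC]
    simp only [one_smul]
    have key : subsum 1 f (x ++ y ++ z ++ t).toFinset (x ++ [A, B] ++ y ++ [A, C] ++ z ++ [B, C] ++ t)
          + subsum 1 f (x ++ y ++ z ++ t).toFinset (x ++ [A, B] ++ y ++ [A] ++ z ++ [B] ++ t)
          + subsum 1 f (x ++ y ++ z ++ t).toFinset (x ++ [A] ++ y ++ [A, C] ++ z ++ [C] ++ t)
          + subsum 1 f (x ++ y ++ z ++ t).toFinset (x ++ [B] ++ y ++ [C] ++ z ++ [B, C] ++ t)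
        = subsum 1 f (x ++ y ++ z ++ t).toFinset (x ++ [B, A] ++ y ++ [C, A] ++ z ++ [C, B] ++ t)
          + subsum 1 f (x ++ y ++ z ++ t).toFinset (x ++ [B, A] ++ y ++ [A] ++ z ++ [B] ++ t)
          + subsum 1 f (x ++ y ++ z ++ t).toFinset (x ++ [A] ++ y ++ [C, A] ++ z ++ [C] ++ t)
          + subsum 1 f (x ++ y ++ z ++ t).toFinset (x ++ [B] ++ y ++ [C] ++ z ++ [C, B] ++ t) := by
      simp only [subsum, ← Finset.sum_add_distrib, ← smul_add]
      refine Finset.sum_congr rfl fun T hT => ?_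
      have hAT : A ∉ T := fun h => hA (by simpa using Finset.mem_powerset.1 hT h)
      have hBT : B ∉ T := fun h => hB (by simpa using Finset.mem_powerset.1 hT h)
      have hCT : C ∉ T := fun h => hC (by simpa using Finset.mem_powerset.1 hT h)
      have hd := isGaussWord_del h T
      simp only [del_append, del_cons_of_notMem hAT, del_cons_of_notMem hBT,
        del_cons_of_notMem hCT, del_nil] at hd ⊢
      rw [hf.third _ _ _ _ _ _ _ hd]
    -- This strips the four summands common to both sides, in which at least two of `A`, `B`, `C`
    -- are deleted. What is left is `key` up to the order of the terms.
    congr 4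
    convert key using 1 <;> abel

theorem RespectsMoves.respectsRelators (hf : RespectsMoves f) :
    RespectsRelators (lettersum (-1) f) where
  iso l g hg := subsum_letters_map (-1) f hf.iso hg
  first x y A h := by
    have hA : A ∉ x ++ y := (h1_facts h).1
    rw [lettersum_h1 h, neg_one_smul, ← sub_eq_add_neg, sub_eq_zero, lettersum]
    refine subsum_congr _ _ fun T hT => ?_
    have hT' : A ∉ T := fun h => hA (by simpa using hT h)
    have hd := isGaussWord_del h T
    simp only [del_append, del_cons_of_notMem hT', del_nil] at hd ⊢
    exact hf.h1 _ _ _ hd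
  second x y z A B h := by
    obtain ⟨hAB, hA, hB, -⟩ := h2_facts h
    have key : subsum (-1) f (x ++ y ++ z).toFinset (x ++ [A, B] ++ y ++ [B, A] ++ z)
        = lettersum (-1) f (x ++ y ++ z) := by
      refine subsum_congr _ _ fun T hT => ?_
      have hAT : A ∉ T := fun h => hA (by simpa using hT h)
      have hBT : B ∉ T := fun h => hB (by simpa using hT h)
      have hd := isGaussWord_del h T
      simp only [del_append, del_cons_of_notMem hAT, del_cons_of_notMem hBT, del_nil] at hd ⊢
      exact hf.h2 _ _ _ _ _ hd
    -- By invariance under H2 the terms keeping both letters sum to the total for `xyz`. The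
    -- one-letter terms cancel, and so do the multiples of that total, with coefficients 1 + 1 - 1 -
    -- 1.
    rw [lettersum_h2 h, lettersum_single hA, lettersum_single hB, key]
    simp only [neg_one_smul]
    abel
  third x y z t A B C h := by
    obtain ⟨⟨hAB, hAC, hBC⟩, ⟨hA, hB, hC⟩, -⟩ := h3_facts h
    have key : subsum (-1) f (x ++ y ++ z ++ t).toFinset
          (x ++ [A, B] ++ y ++ [A, C] ++ z ++ [B, C] ++ t)
        = subsum (-1) f (x ++ y ++ z ++ t).toFinset
          (x ++ [B, A] ++ y ++ [C, A] ++ z ++ [C, B] ++ t) := by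
      refine subsum_congr _ _ fun T hT => ?_
      have hAT : A ∉ T := fun h => hA (by simpa using hT h)
      have hBT : B ∉ T := fun h => hB (by simpa using hT h)
      have hCT : C ∉ T := fun h => hC (by simpa using hT h)
      have hd := isGaussWord_del h T
      simp only [del_append, del_cons_of_notMem hAT, del_cons_of_notMem hBT,
        del_cons_of_notMem hCT, del_nil] at hd ⊢
      exact hf.h3 _ _ _ _ _ _ _ hd
    rw [lettersum_triple hAB hAC hBC hA hB hC, lettersum_triple_swap hAB hAC hBC hA hB hC,
      lettersum_pair_AB hAB hA hB, lettersum_pair_AC hAC hA hC, lettersum_pair_BC hBC hB hC,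
      lettersum_pair_AB_swap hAB hA hB, lettersum_pair_AC_swap hAC hA hC,
      lettersum_pair_BC_swap hBC hB hC, key]
    simp only [neg_one_smul]
    abel

end Transfer

/-! ### Canonical forms and representatives of isomorphism classes -/

/-- The canonical form of a word: each letter is replaced by the position of its first
occurrence. -/
def pat (l : List ℕ) : List ℕ := l.map fun a => l.idxOf a

@[simp] theorem length_pat (l : List ℕ) : (pat l).length = l.length := List.length_map _

theorem idxOf_map_of_injOn {l : List ℕ} {g : ℕ → ℕ} {a : ℕ}
    (hg : ∀ b ∈ l, g b = g a → b = a) : (l.map g).idxOf (g a) = l.idxOf a := by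
  induction l with
  | nil => rfl
  | cons b l ih =>
    rw [List.map_cons, List.idxOf_cons, List.idxOf_cons,
      ih fun c hc => hg c (List.mem_cons_of_mem _ hc)]
    have := hg b List.mem_cons_self
    by_cases hb : b = a
    · subst hb
      simp
    · have : g b ≠ g a := fun h => hb (this h)
      simp [beq_eq_false_iff_ne.2 hb, beq_eq_false_iff_ne.2 this]

theorem pat_map {l : List ℕ} {g : ℕ → ℕ} (hg : Set.InjOn g {a | a ∈ l}) :
    pat (l.map g) = pat l := by
  unfold pat
  rw [List.map_map]
  exact List.map_congr_left fun a ha => idxOf_map_of_injOn fun b hb h => hg hb ha h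

theorem injOn_idxOf (l : List ℕ) : Set.InjOn (fun a => l.idxOf a) {a | a ∈ l} :=
  fun _ ha _ _ h => (List.idxOf_inj ha).1 h

theorem iso_iff_pat_eq {w w' : GaussWord} : Iso w w' ↔ pat w.word = pat w'.word := by
  constructor
  · rintro ⟨g, hg, h⟩
    rw [← h, pat_map hg]
  · intro h
    have hlen : w.word.length = w'.word.length := by simpa using congrArg List.length h
    have key : ∀ a ∈ w.word, w'.word.idxOf (w'.word.getD (w.word.idxOf a) 0)
        = w.word.idxOf a := by
      intro a ha
      have hi : w.word.idxOf a < w.word.length := List.idxOf_lt_length_of_mem ha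
      have h1 : (pat w.word)[w.word.idxOf a]'(by simpa using hi) = w.word.idxOf a := by
        simp [pat]
      have h2 : (pat w'.word)[w.word.idxOf a]'(by simpa [← hlen] using hi)
          = w.word.idxOf a := by
        simpa only [h] using h1
      rw [List.getD_eq_getElem _ _ (by omega)]
      simpa [pat] using h2
    -- A letter goes to the letter of `w'` at the position of its first occurrence in `w`. The
    -- default 0 is reached only outside the letters of `w`.
    refine ⟨fun a => w'.word.getD (w.word.idxOf a) 0, fun a ha b hb hab => ?_, ?_⟩
    · refine injOn_idxOf w.word ha hb ?_
      change w.word.idxOf a = w.word.idxOf b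
      rw [← key a ha, ← key b hb]
      exact congrArg (fun b => w'.word.idxOf b) hab
    · refine List.ext_getElem (by simpa using hlen) fun i h1 h2 => ?_
      have hi : i < w.word.length := by simpa using h1
      have e1 : (pat w.word)[i]'(by simpa using hi) = w.word.idxOf w.word[i] := by simp [pat]
      have e2 : (pat w'.word)[i]'(by simpa using h2) = w'.word.idxOf w'.word[i] := by
        simp [pat]
      have e3 : w.word.idxOf w.word[i] = w'.word.idxOf w'.word[i] := by
        rw [← e1, ← e2]
        simp only [h]
      rw [List.getElem_map, e3, List.getD_eq_getElem _ _ (List.idxOf_lt_length_of_mem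
        (List.getElem_mem h2)), List.getElem_idxOf]

/-- `g` relabels the letters of `l` injectively by numbers less than `n`. -/
def Relabels (g : ℕ → ℕ) (l : List ℕ) (n : ℕ) : Prop :=
  Set.InjOn g {a | a ∈ l} ∧ ∀ a ∈ l, g a < n

theorem map_update_of_notMem {l : List ℕ} {A : ℕ} (hA : A ∉ l) (g : ℕ → ℕ) (n : ℕ) :
    l.map (Function.update g A n) = l.map g :=
  List.map_congr_left fun a ha => Function.update_of_ne (fun h => hA (by rwa [← h])) _ _

theorem Relabels.update {g : ℕ → ℕ} {l : List ℕ} {n A : ℕ} (h : Relabels g l n) (hA : A ∉ l) :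
    Relabels (Function.update g A n) (A :: l) (n + 1) := by
  have hne : ∀ a ∈ l, a ≠ A := fun a ha e => hA (e ▸ ha)
  constructor
  · intro a ha b hb hab
    rcases List.mem_cons.1 ha with rfl | ha' <;>
      rcases List.mem_cons.1 hb with rfl | hb'
    · rfl
    · have := h.2 b hb'
      rw [Function.update_self, Function.update_of_ne (hne b hb')] at hab
      omega
    · have := h.2 a ha'
      rw [Function.update_self, Function.update_of_ne (hne a ha')] at hab
      omega
    · rw [Function.update_of_ne (hne a ha'), Function.update_of_ne (hne b hb')] at hab
      exact h.1 ha' hb' hab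
  · intro a ha
    rcases List.mem_cons.1 ha with rfl | ha
    · simp
    · rw [Function.update_of_ne (hne a ha)]
      exact (h.2 a ha).trans (Nat.lt_succ_self n)

/-- Representatives of the isomorphism classes of Gauss words of rank `n`. -/
def representatives : ℕ → List (List ℕ)
  | 0 => [[]]
  | n + 1 => (representatives n).flatMap fun w =>
      (List.range (w.length + 1)).map fun i => n :: w.take i ++ n :: w.drop i

theorem single_facts {y z : List ℕ} {A : ℕ} (h : IsGaussWord (A :: (y ++ A :: z))) :
    A ∉ y ++ z ∧ IsGaussWord (y ++ z) := by
  rw [isGaussWord_iff_count] at h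
  simp only [List.count_append, List.count_cons] at h
  refine ⟨fun hA => ?_, isGaussWord_iff_count.2 fun a => ?_⟩
  · have h1 := h A
    have := List.count_pos_iff.2 hA
    simp only [List.count_append] at this
    simp only [beq_self_eq_true, if_true] at h1
    omega
  · have h1 := h a
    simp only [List.count_append]
    split_ifs at h1 <;> simp at h1 ⊢ <;> omega

theorem exists_eq_of_isGaussWord_cons {A : ℕ} {l : List ℕ} (h : IsGaussWord (A :: l)) :
    ∃ y z, l = y ++ A :: z := by
  have := h A List.mem_cons_self
  rw [List.count_cons_self] at this
  exact List.append_of_mem (List.count_pos_iff.1 (by omega))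

/-- Induction by removing both occurrences of the first letter, which is then given the new label
`n`. -/
theorem exists_relabels_mem_representatives (n : ℕ) (l : List ℕ) (hl : IsGaussWord l)
    (hn : l.length = 2 * n) :
    ∃ g, Relabels g l n ∧ l.map g ∈ representatives n := by
  induction n generalizing l with
  | zero =>
    obtain rfl := List.length_eq_zero_iff.1 hn
    exact ⟨id, by simp [Relabels], by simp [representatives]⟩
  | succ n ih =>
    obtain _ | ⟨A, l⟩ := l
    · simp at hn
    obtain ⟨y, z, rfl⟩ := exists_eq_of_isGaussWord_cons hl
    obtain ⟨hA, hyz⟩ := single_facts hl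
    obtain ⟨g, hg, hmem⟩ := ih (y ++ z) hyz (by simp at hn ⊢; omega)
    refine ⟨Function.update g A n, ?_, ?_⟩
    · have := hg.update hA
      refine ⟨this.1.mono ?_, fun a ha => this.2 a ?_⟩
      · intro a ha
        simp at ha ⊢
        tauto
      · simp at ha ⊢
        tauto
    · rw [List.mem_append, not_or] at hA
      refine List.mem_flatMap.2 ⟨_, hmem, List.mem_map.2 ⟨y.length, ?_, ?_⟩⟩
      · simp
      · simp [map_update_of_notMem hA.1, map_update_of_notMem hA.2, List.take_left',
          List.drop_left']

/-! ### The function `phi` and the finite verification of its relations -/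

/-- `P` holds for all ways to write `w` as a concatenation of two words. -/
def allSplits (w : List ℕ) (P : List ℕ → List ℕ → Bool) : Bool :=
  (List.range (w.length + 1)).all fun i => P (w.take i) (w.drop i)

theorem of_allSplits {x y : List ℕ} {P : List ℕ → List ℕ → Bool}
    (h : allSplits (x ++ y) P = true) : P x y = true := by
  have := List.all_eq_true.1 h x.length (by simp)
  simpa using this

/-- The canonical forms of the words `w₁, …, w₆`. -/
def patterns : List (List ℕ) :=
  [w1.word, w2.word, w3.word, w4.word, w5.word, w6.word].map pat

/-- The number modulo 2 of the words among `w₁, …, w₆` that are isomorphic to `l`. -/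
def phi (l : List ℕ) : ZMod 2 := (patterns.count (pat l) : ℕ)

theorem phi_map {l : List ℕ} {g : ℕ → ℕ} (hg : Set.InjOn g {a | a ∈ l}) :
    phi (l.map g) = phi l := by rw [phi, phi, pat_map hg]

theorem phi_of_length_ne {l : List ℕ} (h : l.length ≠ 8) : phi l = 0 := by
  have h8 : ∀ p ∈ patterns, p.length = 8 := by decide
  rw [phi, List.count_eq_zero.2 fun hp => h (by simpa using h8 _ hp), Nat.cast_zero]

/-- Only words of rank 4 matter for `phi`, so the word around `AA` has rank 3; its representatives
use the letters 0, 1, 2, and 3 is fresh. -/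
theorem phi_first_check : ∀ w ∈ representatives 3, allSplits w fun x y =>
    phi (x ++ [3, 3] ++ y) = 0 := by decide +kernel

/-- Only the longest term is checked: the other two terms of the second relation are isomorphic and
cancel modulo 2. -/
theorem phi_second_check : ∀ w ∈ representatives 2, allSplits w fun xy z =>
    allSplits xy fun x y => phi (x ++ [2, 3] ++ y ++ [3, 2] ++ z) = 0 := by decide +kernel

/-- The third relation for `phi`. -/
def phiThird (x y z t : List ℕ) (A B C : ℕ) : Prop :=
  phi (x ++ [A, B] ++ y ++ [A, C] ++ z ++ [B, C] ++ t)
      + phi (x ++ [A, B] ++ y ++ [A] ++ z ++ [B] ++ t)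
      + phi (x ++ [A] ++ y ++ [A, C] ++ z ++ [C] ++ t)
      + phi (x ++ [B] ++ y ++ [C] ++ z ++ [B, C] ++ t)
    = phi (x ++ [B, A] ++ y ++ [C, A] ++ z ++ [C, B] ++ t)
      + phi (x ++ [B, A] ++ y ++ [A] ++ z ++ [B] ++ t)
      + phi (x ++ [A] ++ y ++ [C, A] ++ z ++ [C] ++ t)
      + phi (x ++ [B] ++ y ++ [C] ++ z ++ [C, B] ++ t)

instance (x y z t : List ℕ) (A B C : ℕ) : Decidable (phiThird x y z t A B C) :=
  inferInstanceAs (Decidable (_ = _))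

/-- If `xyzt` has rank `n`, the terms of the third relation have ranks `n + 3` and `n + 2`; one of
these is 4 only for `n = 1, 2`. -/
theorem phi_third_check : ∀ n ∈ [1, 2], ∀ w ∈ representatives n, allSplits w fun xyz t =>
    allSplits xyz fun xy z => allSplits xy fun x y => phiThird x y z t n (n + 1) (n + 2) := by
  decide +kernel

theorem phi_first {x y : List ℕ} {A : ℕ} (h : IsGaussWord (x ++ [A, A] ++ y)) :
    phi (x ++ [A, A] ++ y) = 0 := by
  by_cases hlen : (x ++ [A, A] ++ y).length = 8
  swap
  · exact phi_of_length_ne hlen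
  obtain ⟨hA, hxy⟩ := h1_facts h
  obtain ⟨g, hg, hmem⟩ := exists_relabels_mem_representatives 3 _ hxy (by
    simp at hlen ⊢; omega)
  have hg' := (hg.update hA).1
  rw [List.map_append] at hmem
  have hc := of_allSplits (phi_first_check _ hmem)
  rw [List.mem_append, not_or] at hA
  rw [← phi_map (g := Function.update g A 3) (hg'.mono fun a ha => by simp at ha ⊢; tauto)]
  simpa [map_update_of_notMem, hA] using hc

theorem phi_single_eq {x y z : List ℕ} {A B : ℕ} (hA : A ∉ x ++ y ++ z)
    (hB : B ∉ x ++ y ++ z) :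
    phi (x ++ [A] ++ y ++ [A] ++ z) = phi (x ++ [B] ++ y ++ [B] ++ z) := by
  have hid : ∀ l ⊆ x ++ y ++ z, l.map (Equiv.swap A B) = l := fun l hl => by
    conv_rhs => rw [← List.map_id l]
    refine List.map_congr_left fun a ha => Equiv.swap_apply_of_ne_of_ne ?_ ?_
    · rintro rfl; exact hA (hl ha)
    · rintro rfl; exact hB (hl ha)
  rw [← phi_map (Equiv.swap A B).injective.injOn]
  simp only [List.map_append, List.map_cons, List.map_nil, Equiv.swap_apply_left]
  rw [hid x (by intro; simp; tauto), hid y (by intro; simp; tauto), hid z (by intro; simp; tauto)]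

theorem phi_second {x y z : List ℕ} {A B : ℕ}
    (h : IsGaussWord (x ++ [A, B] ++ y ++ [B, A] ++ z)) :
    phi (x ++ [A, B] ++ y ++ [B, A] ++ z) = 0 := by
  obtain ⟨hAB, hA, hB, hs⟩ := h2_facts h
  by_cases hlen : (x ++ [A, B] ++ y ++ [B, A] ++ z).length = 8
  swap
  · exact phi_of_length_ne hlen
  obtain ⟨g, hg, hmem⟩ := exists_relabels_mem_representatives 2 _ hs (by
    simp at hlen ⊢; omega)
  have hg' := ((hg.update hA).update (A := B) (by simpa [hAB.symm] using hB)).1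
  simp only [List.map_append] at hmem
  have hc := of_allSplits (of_allSplits (phi_second_check _ hmem))
  simp only [List.mem_append, not_or] at hA hB
  rw [← phi_map (g := Function.update (Function.update g A 2) B 3)
    (hg'.mono fun a ha => by simp at ha ⊢; tauto)]
  simpa [map_update_of_notMem, hA, hB, hAB] using hc

theorem phiThird_map {x y z t : List ℕ} {A B C : ℕ} {g : ℕ → ℕ}
    (hg : Set.InjOn g {a | a ∈ C :: B :: A :: (x ++ y ++ z ++ t)}) :
    phiThird (x.map g) (y.map g) (z.map g) (t.map g) (g A) (g B) (g C)
      ↔ phiThird x y z t A B C := by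
  have hm : ∀ l : List ℕ, l ⊆ C :: B :: A :: (x ++ y ++ z ++ t) → phi (l.map g) = phi l :=
    fun l hl => phi_map (hg.mono hl)
  unfold phiThird
  iterate 8 rw [← hm (_ ++ t) (fun a ha => by simp at ha ⊢; tauto)]
  simp only [List.map_append, List.map_cons, List.map_nil]

theorem phiThird_of_isGaussWord {x y z t : List ℕ} {A B C : ℕ}
    (h : IsGaussWord (x ++ [A, B] ++ y ++ [A, C] ++ z ++ [B, C] ++ t)) :
    phiThird x y z t A B C := by
  obtain ⟨⟨hAB, hAC, hBC⟩, ⟨hA, hB, hC⟩, hs⟩ := h3_facts h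
  have hlen := length_eq_two_mul_card hs
  generalize (x ++ y ++ z ++ t).toFinset.card = n at hlen
  by_cases hn : n ∈ [1, 2]
  swap
  · have h1 : n ≠ 1 ∧ n ≠ 2 := by simpa using hn
    simp only [List.length_append] at hlen
    rw [phiThird, phi_of_length_ne, phi_of_length_ne, phi_of_length_ne, phi_of_length_ne,
      phi_of_length_ne, phi_of_length_ne, phi_of_length_ne, phi_of_length_ne] <;>
    · simp only [List.length_append, List.length_cons, List.length_nil]
      omega
  obtain ⟨g, hg, hmem⟩ := exists_relabels_mem_representatives n _ hs hlen
  have hg' := (((hg.update hA).update (A := B) (by simpa [hAB.symm] using hB)).update (A := C)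
    (by simpa [hAC.symm, hBC.symm] using hC)).1
  simp only [List.map_append] at hmem
  have hc := of_allSplits (of_allSplits (of_allSplits (phi_third_check n hn _ hmem)))
  simp only [decide_eq_true_eq] at hc
  simp only [List.mem_append, not_or] at hA hB hC
  rw [← phiThird_map hg']
  simpa only [map_update_of_notMem, hA, hB, hC, not_false_eq_true, Function.update_self,
    Function.update_of_ne hAB, Function.update_of_ne hAC, Function.update_of_ne hBC] using hc

theorem respectsRelators_phi : RespectsRelators phi where
  iso _ _ hg := phi_map hg
  first _ _ _ h := phi_first h
  second x y z A B h := by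
    obtain ⟨-, hA, hB, -⟩ := h2_facts h
    rw [phi_second h, phi_single_eq hA hB, zero_add, CharTwo.add_self_eq_zero]
  third _ _ _ _ _ _ _ h := phiThird_of_isGaussWord h

/-! ### Reduction of all words to `w1` by a certificate -/

section Vanishing

variable {M : Type*} [AddCommGroup M] {f : List ℕ → M}

/-- Some two consecutive letters of the word are equal. -/
def hasRepeat : List ℕ → Bool
  | a :: b :: l => a == b || hasRepeat (b :: l)
  | _ => false

theorem exists_of_hasRepeat {l : List ℕ} (h : hasRepeat l = true) :
    ∃ x A y, l = x ++ [A, A] ++ y := by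
  fun_induction hasRepeat l with
  | case1 a b l ih =>
    rcases Bool.or_eq_true_iff.1 h with h | h
    · obtain rfl := beq_iff_eq.1 h
      exact ⟨[], a, l, rfl⟩
    · obtain ⟨x, A, y, hl⟩ := ih h
      exact ⟨a :: x, A, y, by simp [hl]⟩
  | case2 => cases h

theorem RespectsRelators.eq_zero_of_hasRepeat (hf : RespectsRelators f) {l : List ℕ}
    (hl : IsGaussWord l) (h : hasRepeat l = true) : f l = 0 := by
  obtain ⟨x, A, y, rfl⟩ := exists_of_hasRepeat h
  exact hf.first x y A hl

/-- Words of maximal rank have order at most two. -/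
theorem RespectsRelators.two_smul_eq_zero (hf : RespectsRelators f) {n : ℕ}
    (h0 : ∀ l, IsGaussWord l → n < l.length → f l = 0) {l : List ℕ} (hl : IsGaussWord l)
    (hne : l ≠ []) (hn : n ≤ l.length) : (2 : ℤ) • f l = 0 := by
  obtain _ | ⟨A, l⟩ := l
  · exact absurd rfl hne
  obtain ⟨y, z, rfl⟩ := exists_eq_of_isGaussWord_cons hl
  obtain ⟨hA, hyz⟩ := single_facts hl
  -- Doubling `A` by a fresh letter `B` gives a word longer than `n`, which vanishes. The second
  -- relation then says that `f l` plus the value at `l` with `A` renamed `B` is zero, and these two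
  -- values agree.
  obtain ⟨B, hB⟩ := Infinite.exists_notMem_finset (A :: (y ++ A :: z)).toFinset
  simp only [List.toFinset_cons, List.toFinset_append, mem_insert, mem_union, not_or,
    List.mem_toFinset] at hB
  rw [List.mem_append, not_or] at hA
  have hbig : IsGaussWord ([] ++ [A, B] ++ y ++ [B, A] ++ z) := by
    have hc := isGaussWord_iff_count.1 hl
    refine isGaussWord_iff_count.2 fun a => ?_
    have h1 := hc a
    simp only [List.count_append, List.count_cons, List.count_nil] at h1 ⊢
    by_cases hBa : B = a
    · subst hBa
      have hne : (A == B) = false := beq_eq_false_iff_ne.2 (Ne.symm hB.1)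
      simp [List.count_eq_zero.2 hB.2.1, List.count_eq_zero.2 hB.2.2.2, hne]
    · have hne : (B == a) = false := beq_eq_false_iff_ne.2 hBa
      simp only [hne, Bool.false_eq_true, if_false] at h1 ⊢
      omega
  have h2 := hf.second [] y z A B hbig
  have e : f ([] ++ [B] ++ y ++ [B] ++ z) = f (A :: (y ++ A :: z)) := by
    rw [← hf.iso (A :: (y ++ A :: z)) (Equiv.swap A B) (Equiv.swap A B).injective.injOn]
    have hid : ∀ l : List ℕ, A ∉ l → B ∉ l → l.map (Equiv.swap A B) = l := fun l h1 h2 => by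
      conv_rhs => rw [← List.map_id l]
      refine List.map_congr_left fun a ha => Equiv.swap_apply_of_ne_of_ne ?_ ?_
      · rintro rfl; exact h1 ha
      · rintro rfl; exact h2 ha
    simp [hid y hA.1 hB.2.1, hid z hA.2 hB.2.2.2]
  rw [h0 _ hbig (by simp at hn ⊢; omega), e, zero_add] at h2
  rw [two_smul]
  simpa using h2

/-- The value of `f` on a formal combination of words. -/
def combination (f : List ℕ → M) (c : List (ℤ × List ℕ)) : M :=
  (c.map fun p => p.1 • f p.2).sum

/-- The second or third relation, for given subwords `x`, `y`, `z` (and `t`). -/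
def relatorTerms : List (List ℕ) → List (ℤ × List ℕ)
  | [x, y, z] =>
    -- The letters 7, 8, 9 play `A`, `B`, `C`. Because of the test, every input yields a valid
    -- relation, possibly the empty one, so the certificate needs no side conditions.
    if IsGaussWord (x ++ [7, 8] ++ y ++ [8, 7] ++ z) then
      [(1, x ++ [7, 8] ++ y ++ [8, 7] ++ z), (1, x ++ [7] ++ y ++ [7] ++ z),
        (1, x ++ [8] ++ y ++ [8] ++ z)]
    else []
  | [x, y, z, t] =>
    if IsGaussWord (x ++ [7, 8] ++ y ++ [7, 9] ++ z ++ [8, 9] ++ t) then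
      [(1, x ++ [7, 8] ++ y ++ [7, 9] ++ z ++ [8, 9] ++ t),
        (1, x ++ [7, 8] ++ y ++ [7] ++ z ++ [8] ++ t),
        (1, x ++ [7] ++ y ++ [7, 9] ++ z ++ [9] ++ t),
        (1, x ++ [8] ++ y ++ [9] ++ z ++ [8, 9] ++ t),
        (-1, x ++ [8, 7] ++ y ++ [9, 7] ++ z ++ [9, 8] ++ t),
        (-1, x ++ [8, 7] ++ y ++ [7] ++ z ++ [8] ++ t),
        (-1, x ++ [7] ++ y ++ [9, 7] ++ z ++ [9] ++ t),
        (-1, x ++ [8] ++ y ++ [9] ++ z ++ [9, 8] ++ t)]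
    else []
  | _ => []

theorem RespectsRelators.combination_relatorTerms (hf : RespectsRelators f)
    (r : List (List ℕ)) : combination f (relatorTerms r) = 0 := by
  fun_cases relatorTerms r with
  | case1 x y z h =>
    have := hf.second _ _ _ _ _ h
    rw [add_assoc] at this
    simpa only [combination, List.map_cons, List.map_nil, List.sum_cons, List.sum_nil, one_smul,
      add_zero] using this
  | case3 x y z t h =>
    have := sub_eq_zero.2 (hf.third _ _ _ _ _ _ _ h)
    rw [← this]
    simp only [combination, List.map_cons, List.map_nil, List.sum_cons, List.sum_nil, one_smul,
      neg_smul]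
    abel
  | case2 => rfl
  | case4 => rfl
  | case5 => rfl

/-- Adds a term to a formal combination. -/
def insertTerm (k : ℤ) (q : List ℕ) : List (ℤ × List ℕ) → List (ℤ × List ℕ)
  | [] => [(k, q)]
  | (k', q') :: c => if q = q' then (k + k', q) :: c else (k', q') :: insertTerm k q c

theorem combination_insertTerm (k : ℤ) (q : List ℕ) (c : List (ℤ × List ℕ)) :
    combination f (insertTerm k q c) = k • f q + combination f c := by
  induction c with
  | nil => rfl
  | cons p c ih =>
    obtain ⟨k', q'⟩ := p
    unfold insertTerm
    split_ifs with h
    · subst h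
      simp [combination, add_smul, add_assoc]
    · have : combination f ((k', q') :: insertTerm k q c)
          = k' • f q' + combination f (insertTerm k q c) := by simp [combination]
      rw [this, ih]
      simp only [combination, List.map_cons, List.sum_cons]
      abel

/-- An integer combination of relations, as a combination of words in canonical form. -/
def total (s : List (ℤ × List (List ℕ))) : List (ℤ × List ℕ) :=
  s.foldr (fun p c => (relatorTerms p.2).foldr
    (fun q c => insertTerm (p.1 * q.1) (pat q.2) c) c) []

theorem RespectsRelators.apply_pat (hf : RespectsRelators f) (l : List ℕ) : f (pat l) = f l :=
  hf.iso l _ (injOn_idxOf l)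

theorem RespectsRelators.combination_total (hf : RespectsRelators f)
    (s : List (ℤ × List (List ℕ))) : combination f (total s) = 0 := by
  induction s with
  | nil => rfl
  | cons p s ih =>
    have key : ∀ (r c : List (ℤ × List ℕ)), combination f (r.foldr
        (fun q c => insertTerm (p.1 * q.1) (pat q.2) c) c)
        = p.1 • combination f r + combination f c := by
      intro r c
      induction r with
      | nil => simp [combination]
      | cons q r ihr =>
        rw [List.foldr_cons, combination_insertTerm, ihr, hf.apply_pat, mul_smul]
        simp [combination, smul_add, add_assoc]
    change combination f ((relatorTerms p.2).foldr _ (total s)) = 0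
    rw [key, ih, hf.combination_relatorTerms, smul_zero, add_zero]

/-- A test for the vanishing of a term of a combination, where the words in `known` are known
to vanish. -/
def isTrivialTerm (known : List (List ℕ)) (p : ℤ × List ℕ) : Bool :=
  decide (p.1 = 0) || known.contains p.2 || (decide (IsGaussWord p.2) &&
    (hasRepeat p.2 || decide (8 < p.2.length) ||
      (decide (p.2.length = 8) && decide (p.1 % 2 = 0))))

/-- Adds to the list of words known to vanish the one obtained from a combination of
relations. -/
def deduce (known : List (List ℕ)) (s : List (ℤ × List (List ℕ))) : List (List ℕ) :=
  match (total s).filter fun p => !isTrivialTerm known p with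
  | [(k, q)] =>
    -- For a rank 4 word any odd coefficient will do, since such a word has order at most 2.
    if k = 1 ∨ k = -1 ∨ (IsGaussWord q ∧ q.length = 8 ∧ k % 2 = 1) then q :: known else known
  | _ => known

theorem RespectsRelators.smul_eq_zero_of_isTrivialTerm (hf : RespectsRelators f)
    (h0 : ∀ l, IsGaussWord l → 8 < l.length → f l = 0) {known : List (List ℕ)}
    (hk : ∀ q ∈ known, f q = 0) {p : ℤ × List ℕ} (h : isTrivialTerm known p = true) :
    p.1 • f p.2 = 0 := by
  simp only [isTrivialTerm, Bool.or_eq_true, Bool.and_eq_true, decide_eq_true_eq,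
    List.contains_iff_mem] at h
  rcases h with (h | h) | ⟨hg, (h | h) | ⟨h8, h2⟩⟩
  · rw [h, zero_smul]
  · rw [hk _ h, smul_zero]
  · rw [hf.eq_zero_of_hasRepeat hg h, smul_zero]
  · rw [h0 _ hg h, smul_zero]
  · obtain ⟨m, hm⟩ := Int.dvd_of_emod_eq_zero h2
    rw [hm, mul_comm, mul_smul, hf.two_smul_eq_zero h0 hg (by rintro e; simp [e] at h8) h8.ge,
      smul_zero]

/-- Soundness of one deduction: the combination is zero and its trivial terms vanish, so if just one
other term is left, it vanishes as well. -/
theorem RespectsRelators.deduce (hf : RespectsRelators f)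
    (h0 : ∀ l, IsGaussWord l → 8 < l.length → f l = 0) {known : List (List ℕ)}
    (hk : ∀ q ∈ known, f q = 0) (s : List (ℤ × List (List ℕ))) :
    ∀ q ∈ deduce known s, f q = 0 := by
  have key : combination f ((total s).filter fun p => !isTrivialTerm known p) = 0 := by
    rw [← hf.combination_total s]
    induction total s with
    | nil => rfl
    | cons p c ih =>
      by_cases h : isTrivialTerm known p = true
      · rw [List.filter_cons_of_neg (by simp [h]), ih]
        simp [combination, hf.smul_eq_zero_of_isTrivialTerm h0 hk h]
      · rw [List.filter_cons_of_pos (by simpa using h)]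
        simp only [combination, List.map_cons, List.sum_cons] at ih ⊢
        rw [ih]
  unfold GaussWord.deduce
  split
  · rename_i k q hc
    rw [hc] at key
    have hkq : k • f q = 0 := by simpa [combination] using key
    split_ifs with h
    · refine List.forall_mem_cons.2 ⟨?_, hk⟩
      rcases h with rfl | rfl | ⟨hg, h8, h2⟩
      · simpa using hkq
      · simpa using hkq
      · have h2f := hf.two_smul_eq_zero h0 hg (by rintro e; simp [e] at h8) h8.ge
        have : k = (k / 2) * 2 + 1 := by omega
        rw [this, add_smul, mul_smul, h2f, smul_zero, zero_add, one_smul] at hkq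
        exact hkq
    · exact hk
  · exact hk

theorem RespectsRelators.foldl_deduce (hf : RespectsRelators f)
    (h0 : ∀ l, IsGaussWord l → 8 < l.length → f l = 0) (c : List (List (ℤ × List (List ℕ))))
    {known : List (List ℕ)} (hk : ∀ q ∈ known, f q = 0) :
    ∀ q ∈ c.foldl GaussWord.deduce known, f q = 0 := by
  induction c generalizing known with
  | nil => exact hk
  | cons s c ih => exact ih (hf.deduce h0 hk s)

/-- Combinations of relations which show, one after the other, that all non-empty words of rank
at most four are multiples of `w₁`. -/
def certificate : List (List (ℤ × List (List ℕ))) :=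
  [[(1, [[], [], [], [0, 1, 0, 1]])], [(1, [[0], [], [], [1, 0, 1]])],
    [(1, [[0, 1], [], [], [0, 1]])], [(1, [[0, 1, 0], [], [], [1]])],
    [(1, [[0, 1], [], [], [1, 0]])], [(1, [[0, 1], [1], [0]]), (-2, [[0], [], [], [0]])],
    [(1, [[0, 1], [], [1], [0]])], [(1, [[0], [], [1], [1, 0]])], [(1, [[0], [1], [1], [0]])],
    [(1, [[0], [], [], [0]])],
    [(1, [[], [0, 1, 0], [1], []]), (-1, [[], [0], [1, 0, 1]]), (-1, [[], [0], [0, 1], [1]]),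
    (1, [[0], [0], [1], [1]]), (-1, [[0, 1, 0], [], [1], []]), (1, [[0, 1, 0], [1], []])],
    [(1, [[0], [1], [0, 1], []]), (-1, [[], [0, 1], [1, 0]]), (-1, [[0], [], [1, 0], [1]]),
    (-1, [[], [], [0, 1], [0, 1]]), (-1, [[0, 1], [], [0], [1]]), (1, [[0], [1, 0, 1], []])],
    [(-1, [[], [0], [0], []]), (1, [[], [0], [0]]), (-1, [[], [], [], []]), (1, [[0], [0, 1], [1]]),
    (-1, [[0], [], [0], []])], [(1, [[], [], [], []])], [(1, [[], [0], [0]])],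
    [(1, [[0], [0], []])], [(1, [[0], [], [0], []])], [(1, [[0], [0, 1], [1]])],
    [(1, [[0], [], [0, 1], [1]])], [(1, [[], [0], [1, 0, 1]])], [(1, [[], [0, 1], [0, 1]])],
    [(1, [[], [0, 1, 0], [1]])], [(1, [[0], [1, 0], [1]])], [(1, [[0], [1, 0, 1], []])],
    [(1, [[0, 1], [0, 1], []])], [(1, [[0, 1, 0], [1], []])], [(1, [[], [], [0], [1, 0, 1]])],
    [(1, [[], [], [0, 1], [0, 1]])], [(1, [[], [], [0, 1, 0], [1]])],
    [(1, [[], [0, 1, 0], [1], []])], [(1, [[0], [], [1], [0, 1]])], [(1, [[0], [], [1, 0, 1], []])],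
    [(1, [[0, 1], [], [0], [1]])], [(1, [[0, 1, 0], [], [1], []])], [(1, [[], [0, 1], [1, 0]])],
    [(1, [[0], [1], [1, 0], []])], [(1, [[0, 1], [1], [0], []])], [(1, [[], [0], [], [0]])],
    [(1, [[0], [0], [], []])], [(1, [[0], [0, 1], [1], []])], [(1, [[0, 1], [0], [1], []])]]

/-- Starting from `w1` alone, the deductions reach every class not already killed by the first
relation. -/
theorem certificate_check : ∀ n ∈ [1, 2, 3, 4], ∀ w ∈ representatives n,
    hasRepeat w ∨ pat w ∈ certificate.foldl deduce [pat w1.word] := by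
  decide +kernel

theorem RespectsRelators.eq_zero_of_w1 (hf : RespectsRelators f)
    (h0 : ∀ l, IsGaussWord l → 8 < l.length → f l = 0) (h1 : f w1.word = 0) {l : List ℕ}
    (hl : IsGaussWord l) (hne : l ≠ []) : f l = 0 := by
  have hlen := length_eq_two_mul_card hl
  generalize l.toFinset.card = n at hlen
  by_cases hn : 8 < l.length
  · exact h0 l hl hn
  have hpos := List.length_pos_iff.2 hne
  obtain ⟨g, hg, hmem⟩ := exists_relabels_mem_representatives n l hl hlen
  rw [← hf.iso l g hg.1]
  have hmn : n ∈ [1, 2, 3, 4] := by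
    have : n = 1 ∨ n = 2 ∨ n = 3 ∨ n = 4 := by omega
    simpa using this
  rcases certificate_check n hmn _ hmem with h | h
  · exact hf.eq_zero_of_hasRepeat ((isGaussWord_map hg.1).2 hl) h
  · rw [← hf.apply_pat]
    refine hf.foldl_deduce h0 certificate ?_ _ h
    simpa [hf.apply_pat] using h1

end Vanishing

/-! ### Passage between functions on lists, invariants of Gauss words and `G n` -/

theorem RespectsMoves.isHomotopyInvariant {H : Type*} {f : List ℕ → H} (hf : RespectsMoves f) :
    IsHomotopyInvariant fun w => f w.word := by
  intro w w' h
  induction h with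
  | rel w w' h =>
    cases h with
    | iso _ _ h =>
      obtain ⟨g, hg, hgw⟩ := h
      change f w.word = f w'.word
      rw [← hgw, hf.iso _ g hg]
    | h1 x y A h h' => exact hf.h1 x y A h
    | h2 x y z A B h h' => exact hf.h2 x y z A B h
    | h3 x y z t A B C h h' => exact hf.h3 x y z t A B C h
  | refl => rfl
  | symm _ _ _ ih => exact ih.symm
  | trans _ _ _ _ _ ih1 ih2 => exact ih1.trans ih2

section Extend

variable {H : Type*} [AddCommGroup H]

open Classical in
/-- The extension by zero of a function on Gauss words to all words. -/
noncomputable def extend (v : GaussWord → H) (l : List ℕ) : H :=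
  if h : IsGaussWord l then v ⟨l, h⟩ else 0

theorem extend_of_isGaussWord (v : GaussWord → H) {l : List ℕ} (h : IsGaussWord l) :
    extend v l = v ⟨l, h⟩ := dif_pos h

theorem extend_map {v : GaussWord → H} (hv : ∀ w w', Iso w w' → v w = v w') {l : List ℕ}
    {g : ℕ → ℕ} (hg : Set.InjOn g {a | a ∈ l}) : extend v (l.map g) = extend v l := by
  by_cases h : IsGaussWord l
  · have h' := (isGaussWord_map hg).2 h
    rw [extend_of_isGaussWord v h, extend_of_isGaussWord v h']
    exact (hv ⟨l, h⟩ ⟨l.map g, h'⟩ ⟨g, hg, rfl⟩).symm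
  · have h' : ¬ IsGaussWord (l.map g) := fun h' => h ((isGaussWord_map hg).1 h')
    rw [extend, extend, dif_neg h, dif_neg h']

/-- Semi-letters are thereby identified with the weight -1 sums of the inversion formula. -/
theorem lift_semi (v : GaussWord → H) (w : GaussWord) (D : Finset ℕ) :
    FreeAbelianGroup.lift v (w.semi D) = subsum (-1) (extend v) D w.word := by
  rw [semi, map_sum]
  refine Finset.sum_congr rfl fun T _ => ?_
  rw [map_zsmul, FreeAbelianGroup.lift_apply_of,
    extend_of_isGaussWord v (isGaussWord_del w.isGaussWord T)]
  rfl

theorem isGaussWord_of_perm {l l' : List ℕ} (h : IsGaussWord l) (hp : l.Perm l') :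
    IsGaussWord l' := fun a ha => by
  rw [← hp.count_eq]
  exact h a (hp.mem_iff.2 ha)

theorem isGaussWord_swap {x y z t : List ℕ} {A B C : ℕ}
    (h : IsGaussWord (x ++ [A, B] ++ y ++ [A, C] ++ z ++ [B, C] ++ t)) :
    IsGaussWord (x ++ [B, A] ++ y ++ [C, A] ++ z ++ [C, B] ++ t) := by
  refine isGaussWord_of_perm h ?_
  gcongr <;> exact List.Perm.swap _ _ _

theorem isGaussWord_insert {l l' : List ℕ} {A : ℕ} (h : IsGaussWord l) (hA : A ∉ l)
    (hp : (A :: A :: l).Perm l') : IsGaussWord l' := by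
  refine isGaussWord_of_perm (isGaussWord_iff_count.2 fun a => ?_) hp
  have h1 := isGaussWord_iff_count.1 h a
  rw [List.count_cons, List.count_cons]
  by_cases ha : A = a
  · subst ha
    simp [List.count_eq_zero.2 hA]
  · simpa [ha] using h1

theorem IsHomotopyInvariant.respectsMoves {v : GaussWord → H} (hv : IsHomotopyInvariant v) :
    RespectsMoves (extend v) where
  iso l g hg := extend_map (fun w w' h => hv w w' (.rel _ _ (.iso w w' h))) hg
  h1 x y A h := by
    have h' := (h1_facts h).2
    rw [extend_of_isGaussWord v h, extend_of_isGaussWord v h']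
    exact hv _ _ (.rel _ _ (.h1 x y A h h'))
  h2 x y z A B h := by
    have h' := (h2_facts h).2.2.2
    rw [extend_of_isGaussWord v h, extend_of_isGaussWord v h']
    exact hv _ _ (.rel _ _ (.h2 x y z A B h h'))
  h3 x y z t A B C h := by
    have h' := isGaussWord_swap h
    rw [extend_of_isGaussWord v h, extend_of_isGaussWord v h']
    exact hv _ _ (.rel _ _ (.h3 x y z t A B C h h'))

theorem mk_eq_zero_of_relator {n : ℕ} {r : FreeAbelianGroup GaussWord} (h : Relator n r) :
    (QuotientAddGroup.mk r : G n) = 0 :=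
  (QuotientAddGroup.eq_zero_iff r).2 (AddSubgroup.subset_closure h)

theorem toG_eq_of_iso {n : ℕ} {w w' : GaussWord} (h : Iso w w') : toG n w = toG n w' :=
  sub_eq_zero.1 (mk_eq_zero_of_relator (.iso w w' h))

theorem respectsRelators_toG (n : ℕ) : RespectsRelators (extend (toG n)) where
  iso l g hg := extend_map (fun w w' h => toG_eq_of_iso h) hg
  first x y A h := by
    rw [extend_of_isGaussWord _ h]
    exact mk_eq_zero_of_relator (.first x y A h)
  second x y z A B h := by
    obtain ⟨hAB, hA, hB, hs⟩ := h2_facts h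
    have h1 : IsGaussWord (x ++ [A] ++ y ++ [A] ++ z) := isGaussWord_insert hs hA (by
      rw [List.perm_iff_count]; intro a; simp [List.count_cons]; omega)
    have h2 : IsGaussWord (x ++ [B] ++ y ++ [B] ++ z) := isGaussWord_insert hs hB (by
      rw [List.perm_iff_count]; intro a; simp [List.count_cons]; omega)
    rw [extend_of_isGaussWord _ h, extend_of_isGaussWord _ h1, extend_of_isGaussWord _ h2]
    exact mk_eq_zero_of_relator (.second x y z A B h h1 h2)
  third x y z t A B C h := by
    obtain ⟨⟨hAB, hAC, hBC⟩, ⟨hA, hB, hC⟩, hs⟩ := h3_facts h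
    have h' := isGaussWord_swap h
    have sA : IsGaussWord (A :: A :: (x ++ y ++ z ++ t)) := isGaussWord_insert hs hA (.refl _)
    have sB : IsGaussWord (B :: B :: (x ++ y ++ z ++ t)) := isGaussWord_insert hs hB (.refl _)
    have hB' : B ∉ A :: A :: (x ++ y ++ z ++ t) := by simpa [hAB.symm] using hB
    have hC' : C ∉ A :: A :: (x ++ y ++ z ++ t) := by simpa [hAC.symm] using hC
    have hC'' : C ∉ B :: B :: (x ++ y ++ z ++ t) := by simpa [hBC.symm] using hC
    have a1 : IsGaussWord (x ++ [A, B] ++ y ++ [A] ++ z ++ [B] ++ t) :=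
      isGaussWord_insert sA hB' (by
        rw [List.perm_iff_count]; intro a; simp [List.count_cons]; omega)
    have a2 : IsGaussWord (x ++ [A] ++ y ++ [A, C] ++ z ++ [C] ++ t) :=
      isGaussWord_insert sA hC' (by
        rw [List.perm_iff_count]; intro a; simp [List.count_cons]; omega)
    have a3 : IsGaussWord (x ++ [B] ++ y ++ [C] ++ z ++ [B, C] ++ t) :=
      isGaussWord_insert sB hC'' (by
        rw [List.perm_iff_count]; intro a; simp [List.count_cons]; omega)
    have b1 : IsGaussWord (x ++ [B, A] ++ y ++ [A] ++ z ++ [B] ++ t) :=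
      isGaussWord_insert sA hB' (by
        rw [List.perm_iff_count]; intro a; simp [List.count_cons]; omega)
    have b2 : IsGaussWord (x ++ [A] ++ y ++ [C, A] ++ z ++ [C] ++ t) :=
      isGaussWord_insert sA hC' (by
        rw [List.perm_iff_count]; intro a; simp [List.count_cons]; omega)
    have b3 : IsGaussWord (x ++ [B] ++ y ++ [C] ++ z ++ [C, B] ++ t) :=
      isGaussWord_insert sB hC'' (by
        rw [List.perm_iff_count]; intro a; simp [List.count_cons]; omega)
    rw [extend_of_isGaussWord _ h, extend_of_isGaussWord _ a1, extend_of_isGaussWord _ a2,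
      extend_of_isGaussWord _ a3, extend_of_isGaussWord _ h', extend_of_isGaussWord _ b1,
      extend_of_isGaussWord _ b2, extend_of_isGaussWord _ b3]
    exact sub_eq_zero.1 (mk_eq_zero_of_relator (.third x y z t A B C h a1 a2 a3 h' b1 b2 b3))

/-- The homomorphism on `G n` given by a function which respects the relations. -/
def liftG {n : ℕ} {f : List ℕ → H} (hf : RespectsRelators f)
    (h0 : ∀ w : GaussWord, n < w.rank → f w.word = 0) : G n →+ H :=
  QuotientAddGroup.lift _ (FreeAbelianGroup.lift fun w : GaussWord => f w.word) <| by
    rw [AddSubgroup.closure_le]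
    intro r hr
    rw [SetLike.mem_coe, AddMonoidHom.mem_ker]
    cases hr with
    | iso w w' h =>
      obtain ⟨g, hg, hgw⟩ := h
      simp [← hgw, hf.iso _ g hg]
    | first x y A h =>
      simpa only [elt, FreeAbelianGroup.lift_apply_of] using hf.first x y A h
    | second x y z A B h hA hB =>
      simpa only [elt, map_add, FreeAbelianGroup.lift_apply_of] using hf.second x y z A B h
    | third x y z t A B C h =>
      simpa only [elt, map_add, map_sub, FreeAbelianGroup.lift_apply_of, sub_eq_zero]
        using hf.third x y z t A B C h
    | fourth w h => simpa using h0 w h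

theorem liftG_toG {n : ℕ} {f : List ℕ → H} (hf : RespectsRelators f)
    (h0 : ∀ w : GaussWord, n < w.rank → f w.word = 0) (w : GaussWord) :
    liftG hf h0 (toG n w) = f w.word :=
  FreeAbelianGroup.lift_apply_of _ _

theorem length_word (w : GaussWord) : w.word.length = 2 * w.rank :=
  length_eq_two_mul_card w.isGaussWord

end Extend

/-! ### Computation of `G 4` -/

/-- The function which describes the isomorphism from `G 4` to `ℤ × ZMod 2`. -/
def psi (l : List ℕ) : ℤ × ZMod 2 := (if l = [] then 1 else 0, phi l)

theorem psi_of_ne_nil {l : List ℕ} (h : l ≠ []) : psi l = (0, phi l) := by simp [psi, h]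

/-- No word in the first three relations is empty, so the integer coordinate contributes nothing and
only `phi` matters. -/
theorem respectsRelators_psi : RespectsRelators psi where
  iso l g hg := by simp [psi, phi_map hg]
  first x y A h := by rw [psi_of_ne_nil (by simp), respectsRelators_phi.first x y A h]; rfl
  second x y z A B h := by
    rw [psi_of_ne_nil (by simp), psi_of_ne_nil (by simp), psi_of_ne_nil (by simp)]
    exact Prod.ext rfl (respectsRelators_phi.second x y z A B h)
  third x y z t A B C h := by
    iterate 8 rw [psi_of_ne_nil (l := _ ++ t) (by simp)]
    exact Prod.ext rfl (respectsRelators_phi.third x y z t A B C h)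

theorem psi_eq_zero_of_rank (w : GaussWord) (h : 4 < w.rank) : psi w.word = 0 := by
  have := length_word w
  rw [psi_of_ne_nil, phi_of_length_ne (by omega)]
  · rfl
  · intro h0
    rw [h0, List.length_nil] at this
    omega

/-- The homomorphism from `G 4` to `ℤ × ZMod 2`. -/
def homG : G 4 →+ ℤ × ZMod 2 := liftG respectsRelators_psi psi_eq_zero_of_rank

theorem homG_toG (w : GaussWord) : homG (toG 4 w) = psi w.word := liftG_toG _ _ w

theorem homG_empty : homG (toG 4 empty) = (1, 0) := by
  rw [homG_toG]
  decide

theorem phi_w1 : phi w1.word = 1 := by decide +kernel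

theorem homG_w1 : homG (toG 4 w1) = (0, 1) := by
  rw [homG_toG, psi_of_ne_nil (by decide), phi_w1]

theorem extend_toG_eq_zero (l : List ℕ) (hl : IsGaussWord l) (h : 8 < l.length) :
    extend (toG 4) l = 0 := by
  rw [extend_of_isGaussWord _ hl]
  refine mk_eq_zero_of_relator (.fourth _ ?_)
  have := length_word ⟨l, hl⟩
  change l.length = _ at this
  omega

theorem two_smul_toG_w1 : (2 : ℤ) • toG 4 w1 = 0 := by
  have := (respectsRelators_toG 4).two_smul_eq_zero extend_toG_eq_zero w1.isGaussWord
    (by decide) (by decide)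
  rwa [extend_of_isGaussWord _ w1.isGaussWord] at this

/-- The class map followed by the quotient by the multiples of `w1` respects the relations and kills
`w1`, so `RespectsRelators.eq_zero_of_w1` applies to it. -/
theorem toG_mem_zmultiples {w : GaussWord} (hw : w.word ≠ []) :
    toG 4 w ∈ AddSubgroup.zmultiples (toG 4 w1) := by
  have hf : RespectsRelators fun l =>
      QuotientAddGroup.mk' (AddSubgroup.zmultiples (toG 4 w1)) (extend (toG 4) l) := by
    have h := respectsRelators_toG 4
    constructor
    · intro l g hg
      rw [h.iso l g hg]
    · intro x y A hx
      rw [h.first x y A hx, map_zero]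
    · intro x y z A B hx
      simp only [← map_add]
      rw [h.second x y z A B hx, map_zero]
    · intro x y z t A B C hx
      simp only [← map_add]
      rw [h.third x y z t A B C hx]
  have key := hf.eq_zero_of_w1 (fun l hl h => by rw [extend_toG_eq_zero l hl h, map_zero]) (by
    rw [extend_of_isGaussWord _ w1.isGaussWord]
    exact (QuotientAddGroup.eq_zero_iff _).2 (AddSubgroup.mem_zmultiples _)) w.isGaussWord hw
  rw [extend_of_isGaussWord _ w.isGaussWord] at key
  exact (QuotientAddGroup.eq_zero_iff _).1 key

theorem exists_eq_smul_add_smul (g : G 4) :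
    ∃ a b : ℤ, g = a • toG 4 empty + b • toG 4 w1 := by
  obtain ⟨r, rfl⟩ := QuotientAddGroup.mk_surjective g
  induction r using FreeAbelianGroup.induction_on with
  | zero => exact ⟨0, 0, by simp⟩
  | of w =>
    by_cases hw : w.word = []
    · have : w = empty := GaussWord.ext hw
      exact ⟨1, 0, by rw [this, one_smul, zero_smul, add_zero]; rfl⟩
    · obtain ⟨b, hb⟩ := AddSubgroup.mem_zmultiples_iff.1 (toG_mem_zmultiples hw)
      exact ⟨0, b, by rw [hb, zero_smul, zero_add]; rfl⟩
  | neg w ih =>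
    obtain ⟨a, b, h⟩ := ih
    refine ⟨-a, -b, ?_⟩
    rw [QuotientAddGroup.mk_neg, h]
    simp only [neg_smul]
    abel
  | add r s ihr ihs =>
    obtain ⟨a, b, h⟩ := ihr
    obtain ⟨a', b', h'⟩ := ihs
    refine ⟨a + a', b + b', ?_⟩
    rw [QuotientAddGroup.mk_add, h, h']
    simp only [add_smul]
    abel

theorem homG_smul_add_smul (a b : ℤ) :
    homG (a • toG 4 empty + b • toG 4 w1) = (a, (b : ZMod 2)) := by
  rw [map_add, map_zsmul, map_zsmul, homG_empty, homG_w1]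
  simp

theorem homG_bijective : Function.Bijective homG := by
  constructor
  · rw [injective_iff_map_eq_zero]
    intro g hg
    obtain ⟨a, b, rfl⟩ := exists_eq_smul_add_smul g
    rw [homG_smul_add_smul] at hg
    obtain ⟨ha, hb⟩ := Prod.ext_iff.1 hg
    obtain rfl : a = 0 := ha
    obtain ⟨m, rfl⟩ := (ZMod.intCast_zmod_eq_zero_iff_dvd b 2).1 hb
    rw [zero_smul, zero_add, Nat.cast_ofNat, mul_comm, mul_smul, two_smul_toG_w1, smul_zero]
  · rintro ⟨a, b⟩
    obtain ⟨b, rfl⟩ := ZMod.intCast_surjective b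
    exact ⟨_, homG_smul_add_smul a b⟩

/-! ### The invariant `v4` and its degree -/

theorem cast_angle (q w : GaussWord) :
    (angle q w : ZMod 2)
      = ∑ T ∈ w.letters.powerset, if pat (del T w.word) = pat q.word then 1 else 0 := by
  classical
  rw [angle, Finset.natCast_card_filter]
  refine Finset.sum_congr rfl fun T _ => ?_
  simp only [iso_iff_pat_eq]
  congr

theorem v4_eq_sum (w : GaussWord) : v4 w = ∑ T ∈ w.letters.powerset, phi (del T w.word) := by
  simp only [v4, Nat.cast_add, cast_angle, ← Finset.sum_add_distrib]
  refine Finset.sum_congr rfl fun T _ => ?_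
  simp only [phi, patterns, List.map_cons, List.map_nil, List.count_cons, List.count_nil,
    Nat.cast_add, Nat.cast_ite, Nat.cast_one, Nat.cast_zero, beq_iff_eq,
    eq_comm (b := pat (del T w.word))]
  ring

theorem v4_eq_lettersum : v4 = fun w => lettersum 1 phi w.word := by
  funext w
  simp [v4_eq_sum, lettersum, subsum, letters]

theorem isHomotopyInvariant_v4 : IsHomotopyInvariant v4 :=
  v4_eq_lettersum ▸ respectsRelators_phi.respectsMoves.isHomotopyInvariant

/-- Since `v4` sums `phi` over all subwords, the alternating sum over `D` undoes the summation over
those letters; only subwords that keep all of `D` remain. -/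
theorem lift_v4_semi (w : GaussWord) {D : Finset ℕ} (hD : D ⊆ w.letters) :
    FreeAbelianGroup.lift v4 (w.semi D) = subsum 1 phi (w.letters \ D) w.word := by
  rw [lift_semi, ← sum_subsum_of_add_eq_zero 1 phi (δ := -1) (by norm_num)
    (Finset.disjoint_sdiff (s := D))]
  refine Finset.sum_congr rfl fun T hT => ?_
  have hTD := Finset.mem_powerset.1 hT
  rw [extend_of_isGaussWord _ (isGaussWord_del w.isGaussWord T), v4_eq_lettersum]
  simp only [lettersum, toFinset_del]
  congr 2
  change w.letters \ T = _
  ext a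
  have := @hD a
  have := @hTD a
  simp only [mem_sdiff, mem_union]
  tauto

theorem isFiniteTypeLE_v4 : IsFiniteTypeLE v4 4 := by
  refine ⟨isHomotopyInvariant_v4, fun w D hD h => ?_⟩
  rw [lift_v4_semi w hD]
  refine Finset.sum_eq_zero fun T hT => ?_
  rw [phi_of_length_ne, smul_zero]
  rw [length_eq_two_mul_card (isGaussWord_del w.isGaussWord T), toFinset_del]
  -- Every remaining subword contains `D`, so its rank exceeds 4, where `phi` vanishes.
  have : D ⊆ w.word.toFinset \ T := fun a ha =>
    Finset.mem_sdiff.2 ⟨hD ha, fun haT =>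
      (Finset.mem_sdiff.1 (Finset.mem_powerset.1 hT haT)).2 ha⟩
  have := Finset.card_le_card this
  omega

theorem isFiniteTypeOfDegree_v4 : IsFiniteTypeOfDegree v4 4 := by
  refine ⟨isFiniteTypeLE_v4, fun m hm => ?_⟩
  by_contra! hlt
  -- With all four letters of `w1` made semi-letters, only `w1` itself survives, and `phi` equals 1
  -- there.
  have h := hm.2 w1 w1.letters (Finset.Subset.refl _) (hlt.trans_le (by decide))
  rw [lift_v4_semi w1 (Finset.Subset.refl _), Finset.sdiff_self, subsum_empty, phi_w1] at h
  exact one_ne_zero h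

/-! ### Universality of the sum of subwords -/

/-- The sum of the classes of all subwords of `w`. -/
def subwordSum (w : GaussWord) : G 4 := ∑ T ∈ w.letters.powerset, toG 4 (w.delete T)

theorem homG_subwordSum (w : GaussWord) : homG (subwordSum w) = (1, v4 w) := by
  have h : ∀ T, homG (toG 4 (w.delete T)) = psi (del T w.word) := fun T => homG_toG _
  simp only [subwordSum, map_sum, h]
  refine Prod.ext ?_ ?_
  -- The integer coordinate counts the empty subwords, and only deleting all letters produces one.
  · rw [Prod.fst_sum, Finset.sum_eq_single w.letters]
    · have : del w.letters w.word = [] := by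
        rw [List.eq_nil_iff_forall_not_mem]
        intro a ha
        rw [mem_del] at ha
        exact ha.2 (List.mem_toFinset.2 ha.1)
      simp [psi, this]
    · intro T hT hne
      refine if_neg fun h0 => hne (Finset.Subset.antisymm (Finset.mem_powerset.1 hT) ?_)
      have := toFinset_del T w.word
      rw [h0, List.toFinset_nil, eq_comm, Finset.sdiff_eq_empty_iff_subset] at this
      exact this
    · intro h
      exact absurd (Finset.mem_powerset_self _) h
  · rw [Prod.snd_sum, v4_eq_sum]
    rfl

/-- The homomorphism is induced by the alternating sum of `v`. The degree bound makes that sum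
vanish above rank 4, and the inversion formula recovers `v` by summing over subwords. -/
theorem exists_hom_of_isFiniteTypeLE {H : Type*} [AddCommGroup H] {v : GaussWord → H}
    (hv : IsFiniteTypeLE v 4) : ∃ g : G 4 →+ H, ∀ w, v w = g (subwordSum w) := by
  have hf := hv.1.respectsMoves.respectsRelators
  have h0 : ∀ w : GaussWord, 4 < w.rank → lettersum (-1) (extend v) w.word = 0 := fun w h => by
    rw [← hv.2 w w.letters (Finset.Subset.refl _) h, lift_semi]
    rfl
  refine ⟨liftG hf h0, fun w => ?_⟩
  have h := sum_subsum_of_add_eq_zero (-1) (extend v) (δ := 1) (by norm_num)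
    (Finset.disjoint_empty_right w.letters) w.word
  rw [subsum_empty, extend_of_isGaussWord v w.isGaussWord] at h
  rw [subwordSum, map_sum]
  refine h.symm.trans (Finset.sum_congr rfl fun T _ => ?_)
  rw [liftG_toG, one_pow, one_smul, Finset.empty_union]
  change _ = lettersum (-1) (extend v) (del T w.word)
  rw [lettersum, toFinset_del]
  rfl

end GaussWord

theorem mainTheorem1 :
    (∃ e : GaussWord.G 4 ≃+ ℤ × ZMod 2,
      e (GaussWord.toG 4 GaussWord.empty) = (1, 0) ∧
      e (GaussWord.toG 4 GaussWord.w1) = (0, 1)) ∧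
    GaussWord.IsFiniteTypeOfDegree GaussWord.v4 4 ∧
    (∀ (H : Type*) [AddCommGroup H] (v : GaussWord → H), GaussWord.IsFiniteTypeLE v 4 →
      ∀ w w' : GaussWord, v w ≠ v w' → GaussWord.v4 w ≠ GaussWord.v4 w') := by
  refine ⟨⟨AddEquiv.ofBijective GaussWord.homG GaussWord.homG_bijective, GaussWord.homG_empty,
    GaussWord.homG_w1⟩, GaussWord.isFiniteTypeOfDegree_v4, ?_⟩
  intro H _ v hv w w' hne h
  obtain ⟨g, hg⟩ := GaussWord.exists_hom_of_isFiniteTypeLE hv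
  refine hne ?_
  rw [hg, hg]
  congr 1
  -- Both subword sums have integer coordinate 1, so equal values of `v4` give them equal images
  -- under the injective `homG`.
  apply GaussWord.homG_bijective.1
  rw [GaussWord.homG_subwordSum, GaussWord.homG_subwordSum, h]
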